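/- Let $P\ge 2$, let $f_1,\dots,f_P:\mathbb{R}^n\to\mathbb{R}\cup\{+\infty\}$ be closed and convex (i.e. with closed, convex epigraphs) and not identically $+\infty$, and assume that the problem $\min_{x\in\mathbb{R}^n}\sum_{p=1}^P f_p(x)$ is solvable, i.e. it has a minimizer with finite value. Let $\mathcal{G}=(\mathcal{V},\mathcal{E})$, $\mathcal{V}=\{1,\dots,P\}$, be a fixed connected simple undirected graph, where each edge is written $(i,j)$ with $i<j$; let $\mathcal{N}_p$ and $D_p=|\mathcal{N}_p|$ be the neighborhood and the degree of node $p$. Let $\mathcal{C}:\mathcal{V}\to\{1,\dots,C\}$ be a proper coloring of $\mathcal{G}$ (adjacent nodes have different colors) that uses all $C$ colors, let $\mathcal{C}_c$ be the set of nodes of color $c$, let $\rho>0$, and put $\tau_p=1/(\rho D_p)$. D-ADMM generates $(x_p^k,\gamma_p^k)_{p\in\mathcal{V},\,k\ge 0}$ in $\mathbb{R}^n$ as follows: $x_p^0=\gamma_p^0=0$ for all $p$ and, for $k=0,1,2,\dots$, first, going through the colors $c=1,\dots,C$ in this order, for all $p\in\mathcal{C}_c$, $$z_p^k=\frac1{D_p}\Bigl(\sum_{j\in\mathcal{N}_p,\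 \mathcal{C}(j)<\mathcal{C}(p)}x_j^{k+1}+\sum_{j\in\mathcal{N}_p,\ \mathcal{C}(j)>\mathcal{C}(p)}x_j^{k}\Bigr),\qquad x_p^{k+1}=\operatorname{prox}_{\tau_pf_p}\bigl(z_p^k-\tau_p\gamma_p^k\bigr),$$ and then, for all $p\in\mathcal{V}$, $$\gamma_p^{k+1}=\gamma_p^k+\rho\sum_{j\in\mathcal{N}_p}\bigl(x_p^{k+1}-x_j^{k+1}\bigr).$$ Here $\operatorname{prox}_g(v)=\arg\min_y\, g(y)+\tfrac12\|y-v\|^2$. Suppose that at least one of the following conditions holds: (a) $C=2$, and strong duality holds for the edge-based reformulation: $\min\sum_p f_p(x_p)$ subject to $x_i=x_j$ for all $(i,j)\in\mathcal{E}$, i.e. there is a multiplier $\lambda=(\lambda_{ij})_{(i,j)\in\mathcal{E}}$ with $\lambda_{ij}\in\mathbb{R}^n$ whose dual value $\inf_{x_1,\dots,x_P}\bigl[\sum_p f_p(x_p)+\sum_{(i,j)\in\mathcal{E}}\lambda_{ij}^\top(x_i-x_j)\bigr]$ equals the optimal value of the reformulation; (b) each $f_p$ is strongly convex with some modulus $\mu_p>0$,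 and $$0<\rho<\min_{c=1,\dots,C}\frac{2\sum_{p\in\mathcal{C}_c}\mu_p}{3\,(C-1)\,\max_{p\in\mathcal{C}_c}D_p}.$$ Then D-ADMM is well defined (there is exactly one such sequence), and there is a minimizer $x^\star$ of $\sum_{p=1}^P f_p$ such that $(x_1^k,\dots,x_P^k)\to(x^\star,\dots,x^\star)$ as $k\to\infty$. -/

import Mathlib

open Filter Topology Finset

noncomputable section

namespace DADMM

/-- The epigraph `{(x, r) | f x ≤ r}` of an extended-real-valued function on `ℝⁿ`. -/
def epigraph {n : ℕ} (f : EuclideanSpace ℝ (Fin n) → EReal) :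
    Set (EuclideanSpace ℝ (Fin n) × ℝ) :=
  {q | f q.1 ≤ (q.2 : EReal)}

/-- `f : ℝⁿ → ℝ ∪ {+∞}` is closed and convex (it has a closed and convex epigraph) and not
identically `+∞`. -/
structure IsClosedProperConvex {n : ℕ} (f : EuclideanSpace ℝ (Fin n) → EReal) : Prop where
  ne_bot : ∀ x, f x ≠ ⊥
  ne_top : ∃ x, f x ≠ ⊤
  closed : IsClosed (epigraph f)
  convex : Convex ℝ (epigraph f)

/-- `f` is strongly convex with modulus `μ > 0`. -/
def IsStronglyConvex {n : ℕ} (μ : ℝ) (f : EuclideanSpace ℝ (Fin n) → EReal) : Prop :=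
  0 < μ ∧ ∀ x y : EuclideanSpace ℝ (Fin n), ∀ a b : ℝ, 0 < a → 0 < b → a + b = 1 →
    f (a • x + b • y) + ((μ / 2 * a * b * ‖x - y‖ ^ 2 : ℝ) : EReal)
      ≤ (a : EReal) * f x + (b : EReal) * f y

/-- `xs` solves the problem `minimize ∑ p, f p x` over `x ∈ ℝⁿ`
(the optimal value of a solvable problem is finite). -/
def IsSolution {n P : ℕ} (f : Fin P → EuclideanSpace ℝ (Fin n) → EReal)
    (xs : EuclideanSpace ℝ (Fin n)) : Prop :=
  ∑ p, f p xs ≠ ⊤ ∧ ∀ x, ∑ p, f p xs ≤ ∑ p, f p x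

/-- `y` is the point `prox_g(v)`, a minimizer of `w ↦ g w + ‖w - v‖² / 2`. -/
def IsProx {n : ℕ} (g : EuclideanSpace ℝ (Fin n) → EReal) (v y : EuclideanSpace ℝ (Fin n)) :
    Prop :=
  ∀ w, g y + ((1 / 2 * ‖y - v‖ ^ 2 : ℝ) : EReal) ≤ g w + ((1 / 2 * ‖w - v‖ ^ 2 : ℝ) : EReal)

/-- The optimal value of the edge-based reformulation
`minimize ∑ p, f p (x p)` subject to `x i = x j` for every edge `(i, j)`. -/
def edgeOptimalValue {n P : ℕ} (G : SimpleGraph (Fin P))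
    (f : Fin P → EuclideanSpace ℝ (Fin n) → EReal) : EReal :=
  ⨅ x : {x : Fin P → EuclideanSpace ℝ (Fin n) // ∀ i j, G.Adj i j → x i = x j},
    ∑ p, f p (x.1 p)

/-- The Lagrangian of the edge-based reformulation. The multiplier of the constraint `x i = x j`,
for an edge with `i < j`, is `lam i j`; the other entries of `lam` are not used. -/
def lagrangian {n P : ℕ} (G : SimpleGraph (Fin P)) [DecidableRel G.Adj]
    (f : Fin P → EuclideanSpace ℝ (Fin n) → EReal)
    (x : Fin P → EuclideanSpace ℝ (Fin n)) (lam : Fin P → Fin P → EuclideanSpace ℝ (Fin n)) :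
    EReal :=
  ∑ p, f p (x p) +
    ((∑ i, ∑ j ∈ G.neighborFinset i with i < j, inner ℝ (lam i j) (x i - x j) : ℝ) : EReal)

/-- The dual function of the edge-based reformulation. -/
def dualFunction {n P : ℕ} (G : SimpleGraph (Fin P)) [DecidableRel G.Adj]
    (f : Fin P → EuclideanSpace ℝ (Fin n) → EReal)
    (lam : Fin P → Fin P → EuclideanSpace ℝ (Fin n)) : EReal :=
  ⨅ x : Fin P → EuclideanSpace ℝ (Fin n), lagrangian G f x lam

/-- Strong duality for the edge-based reformulation: the dual function takes the primal optimal
value. By weak duality this value is then the maximum of the dual function. -/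
def StrongDuality {n P : ℕ} (G : SimpleGraph (Fin P)) [DecidableRel G.Adj]
    (f : Fin P → EuclideanSpace ℝ (Fin n) → EReal) : Prop :=
  ∃ lam : Fin P → Fin P → EuclideanSpace ℝ (Fin n),
    dualFunction G f lam = edgeOptimalValue G f

/-- The step size `τ_p = 1 / (ρ D_p)`, where `D_p` is the degree of node `p`. -/
def tau {P : ℕ} (G : SimpleGraph (Fin P)) [DecidableRel G.Adj] (ρ : ℝ) (p : Fin P) : ℝ :=
  1 / (ρ * (G.degree p : ℝ))

/-- The average `z_p^k` of the estimates of the neighbours of `p`: neighbours with a smaller color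
contribute their new estimates `xnew`, those with a larger color their old estimates `xold`. -/
def neighborAverage {n P C : ℕ} (G : SimpleGraph (Fin P)) [DecidableRel G.Adj]
    (col : G.Coloring (Fin C)) (xnew xold : Fin P → EuclideanSpace ℝ (Fin n)) (p : Fin P) :
    EuclideanSpace ℝ (Fin n) :=
  (1 / (G.degree p : ℝ)) •
    (∑ j ∈ G.neighborFinset p with col j < col p, xnew j +
      ∑ j ∈ G.neighborFinset p with col p < col j, xold j)

/-- `x k p` and `γ k p` are the iterates `x_p^k` and `γ_p^k` of D-ADMM. -/
structure IsRun {n P C : ℕ} (G : SimpleGraph (Fin P)) [DecidableRel G.Adj]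
    (col : G.Coloring (Fin C)) (f : Fin P → EuclideanSpace ℝ (Fin n) → EReal) (ρ : ℝ)
    (x γ : ℕ → Fin P → EuclideanSpace ℝ (Fin n)) : Prop where
  init_x : ∀ p, x 0 p = 0
  init_γ : ∀ p, γ 0 p = 0
  step_x : ∀ k p, IsProx (fun y => (tau G ρ p : EReal) * f p y)
    (neighborAverage G col (x (k + 1)) (x k) p - tau G ρ p • γ k p) (x (k + 1) p)
  step_γ : ∀ k p, γ (k + 1) p = γ k p + ρ • ∑ j ∈ G.neighborFinset p, (x (k + 1) p - x (k + 1) j)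

/-- The set `C_c` of the nodes with color `c`. -/
def colorClass {P C : ℕ} {G : SimpleGraph (Fin P)} (col : G.Coloring (Fin C)) (c : Fin C) :
    Finset (Fin P) :=
  {p | col p = c}

/-- The largest degree of a node with color `c`. -/
def maxDegreeOfColor {P C : ℕ} (G : SimpleGraph (Fin P)) [DecidableRel G.Adj]
    (col : G.Coloring (Fin C)) (c : Fin C) : ℕ :=
  (colorClass col c).sup fun p => G.degree p

end DADMM

end

/-! Orient each edge from its smaller to its larger color and let λ_ij^k be ρ times the sum of x_i^t
- x_j^t over t = 1, ..., k. Then γ^k is the divergence of λ^k, and the prox conditions of a sweep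
say that minus the divergence of λ^{k+1} at p, minus ρ ∑_{p→j} (x_j^{k+1} - x_j^k), is a subgradient
of f_p at x_p^{k+1}. By `energy_identity`, the energy ∑_{i→j} (‖λ_ij‖²/(2ρ) + ρ‖x_j‖²/2) drops by
(ρ/2) ∑_{i→j} ‖x_i^{k+1} - x_j^k‖² plus the pairing of subgradients with iterates. The relations
behind it are linear, so it also holds for differences, where monotonicity of subdifferentials makes
the pairing nonnegative. For consecutive iterates this makes the pairings of increments summable.

Strong duality gives a saddle point. The energy relative to it decreases, so the residuals x_i^{k+1}
- x_j^k vanish on oriented edges. Together with the summable pairings this makes the increments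
vanish at a node of least color, and residuals carry this to all nodes. Hence consensus holds, a
cluster point is a saddle point, and the decreasing energy relative to it has a subsequence tending
to 0.

Under strong convexity a multiplier may be missing. There the squared increments are summable, so
the Lagrangian values L_k increase up to a summable error; they are bounded above, so they converge
and the squared edge violations q_k are summable. The multipliers grow at most like √k while k q_k
is small infinitely often, so along a subsequence the multiplier term vanishes. Lower semicontinuity
then identifies lim L_k with the optimal value, and the optimality gap controls the distance to the
minimizer. -/

namespace DADMM

/-! ### Subgradients and proximal points of closed convex functions -/

section

variable {n : ℕ}

/-- `g` is a subgradient of `f` at the point `x` of its domain. -/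
def IsSubgradient (f : EuclideanSpace ℝ (Fin n) → EReal) (x g : EuclideanSpace ℝ (Fin n)) : Prop :=
  f x ≠ ⊤ ∧ ∀ w, f x + ((inner ℝ g (w - x) : ℝ) : EReal) ≤ f w

namespace IsClosedProperConvex

variable {f : EuclideanSpace ℝ (Fin n) → EReal}

theorem coe_toReal (hf : IsClosedProperConvex f) {x : EuclideanSpace ℝ (Fin n)} (hx : f x ≠ ⊤) :
    ((f x).toReal : EReal) = f x :=
  EReal.coe_toReal hx (hf.ne_bot x)

theorem le_combination (hf : IsClosedProperConvex f) {x y : EuclideanSpace ℝ (Fin n)}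
    (hx : f x ≠ ⊤) (hy : f y ≠ ⊤) {a b : ℝ} (ha : 0 ≤ a) (hb : 0 ≤ b) (hab : a + b = 1) :
    f (a • x + b • y) ≤ ((a * (f x).toReal + b * (f y).toReal : ℝ) : EReal) := by
  have h1 : (x, (f x).toReal) ∈ epigraph f := (hf.coe_toReal hx).ge
  have h2 : (y, (f y).toReal) ∈ epigraph f := (hf.coe_toReal hy).ge
  exact hf.convex h1 h2 ha hb hab

theorem lowerSemicontinuous (hf : IsClosedProperConvex f) : LowerSemicontinuous f := by
  rw [lowerSemicontinuous_iff_isClosed_preimage]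
  intro y
  induction y with
  | bot =>
    have : f ⁻¹' Set.Iic ⊥ = ∅ := by
      ext x
      simp [hf.ne_bot x]
    rw [this]
    exact isClosed_empty
  | top => simp
  | coe r =>
    have : f ⁻¹' Set.Iic (r : EReal) = (fun x => (x, r)) ⁻¹' epigraph f := by
      ext x
      simp [epigraph]
    rw [this]
    exact hf.closed.preimage (by fun_prop)

/-- By lower semicontinuity `f` has a minimum on the unit ball around `x₀`. For `w` outside, the
point of the segment at distance one from `x₀` has at least that value, and convexity bounds `f w`
from below. This is the growth control needed for the existence of proximal points. -/
theorem exists_lower_bound (hf : IsClosedProperConvex f) {x₀ : EuclideanSpace ℝ (Fin n)}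
    (hx₀ : f x₀ ≠ ⊤) :
    ∃ K : ℝ, 0 ≤ K ∧ ∀ w, ((-(K * (1 + ‖w - x₀‖)) : ℝ) : EReal) ≤ f w := by
  obtain ⟨y, hyB, hy⟩ := (hf.lowerSemicontinuous.lowerSemicontinuousOn _).exists_isMinOn
    (s := Metric.closedBall x₀ 1) ⟨x₀, by simp⟩ (isCompact_closedBall x₀ 1)
  have hmin : ∀ z, ‖z - x₀‖ ≤ 1 → f y ≤ f z := fun z hz =>
    hy (by simpa [dist_eq_norm] using hz)
  have hytop : f y ≠ ⊤ := ne_top_of_le_ne_top hx₀ (hmin x₀ (by simp))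
  set m := (f y).toReal with hm
  set t₀ := (f x₀).toReal with ht₀
  have hmy : (m : EReal) = f y := hf.coe_toReal hytop
  refine ⟨|m| + |t₀|, by positivity, fun w => ?_⟩
  have h1 := abs_nonneg m
  have h2 := abs_nonneg t₀
  have h3 := neg_abs_le m
  have h4 := le_abs_self t₀
  have hr0 := norm_nonneg (w - x₀)
  rcases le_or_gt ‖w - x₀‖ 1 with hr | hr
  · refine le_trans ?_ (hmy.le.trans (hmin w hr))
    rw [EReal.coe_le_coe_iff]
    nlinarith
  · by_cases hw : f w = ⊤
    · simp [hw]
    set r := ‖w - x₀‖ with hrdef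
    have hrpos : 0 < r := by linarith
    have hc := hf.le_combination hx₀ hw (a := 1 - 1 / r) (b := 1 / r)
      (by rw [sub_nonneg, div_le_one hrpos]; exact hr.le) (by positivity) (by ring)
    have hpt : (1 - 1 / r) • x₀ + (1 / r) • w - x₀ = (1 / r) • (w - x₀) := by module
    have hb : ‖(1 - 1 / r) • x₀ + (1 / r) • w - x₀‖ ≤ 1 := by
      rw [hpt, norm_smul, Real.norm_of_nonneg (by positivity), ← hrdef]
      field_simp
      exact le_rfl
    have hmain := hmy.le.trans ((hmin _ hb).trans hc)
    rw [EReal.coe_le_coe_iff] at hmain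
    rw [← hf.coe_toReal hw, EReal.coe_le_coe_iff]
    have hmul : r * m ≤ (r - 1) * t₀ + (f w).toReal := by
      calc r * m ≤ r * ((1 - 1 / r) * t₀ + 1 / r * (f w).toReal) := by gcongr
        _ = (r - 1) * t₀ + (f w).toReal := by field_simp
    nlinarith

/-- The quadratic term beats the linear lower bound on `f`, so outside a large ball the objective
exceeds its value at `x₀`, and a minimizer over the ball is global. -/
theorem exists_isProx (hf : IsClosedProperConvex f) {τ : ℝ} (hτ : 0 < τ)
    (v : EuclideanSpace ℝ (Fin n)) : ∃ y, IsProx (fun y => (τ : EReal) * f y) v y := by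
  obtain ⟨x₀, hx₀⟩ := hf.ne_top
  obtain ⟨K, hK, hKf⟩ := hf.exists_lower_bound hx₀
  set t₀ := (f x₀).toReal with ht₀
  set d := ‖x₀ - v‖ with hd
  have hd0 : 0 ≤ d := norm_nonneg _
  have h2 := abs_nonneg t₀
  have h4 := le_abs_self t₀
  -- For `r > R` the first two terms give `r / 2 - τ * K - d ≥ 1`; the last makes the resulting gain
  -- `r` at least `τ * (K + |t₀|)`.
  set R : ℝ := 2 * (τ * K + d) + 2 + τ * (K + |t₀|) with hR
  have hRpos : 0 ≤ R := by positivity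
  have hlsc : LowerSemicontinuous
      (fun w => (τ : EReal) * f w + ((1 / 2 * ‖w - v‖ ^ 2 : ℝ) : EReal)) := by
    refine LowerSemicontinuous.add' ?_ ?_ ?_
    · have hmono : Monotone fun t : EReal => (τ : EReal) * t := fun a b hab =>
        mul_le_mul_of_nonneg_left hab (by exact_mod_cast hτ.le)
      refine Continuous.comp_lowerSemicontinuous ?_ hf.lowerSemicontinuous hmono
      have hτ0 : (τ : EReal) ≠ 0 := by simpa using hτ.ne'
      exact continuous_iff_continuousAt.mpr fun t =>
        (EReal.continuousAt_mul (p := ((τ : EReal), t)) (Or.inl hτ0) (Or.inl hτ0)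
          (Or.inl (EReal.coe_ne_bot _)) (Or.inl (EReal.coe_ne_top _))).comp
          (f := fun t => ((τ : EReal), t)) (by fun_prop)
    · exact (continuous_coe_real_ereal.comp (by fun_prop)).lowerSemicontinuous
    · intro x
      exact EReal.continuousAt_add (Or.inr (EReal.coe_ne_bot _)) (Or.inr (EReal.coe_ne_top _))
  obtain ⟨y, hyB, hy⟩ := (hlsc.lowerSemicontinuousOn _).exists_isMinOn
    (s := Metric.closedBall x₀ R) ⟨x₀, by simpa using hRpos⟩ (isCompact_closedBall x₀ R)
  refine ⟨y, fun w => ?_⟩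
  rcases le_or_gt ‖w - x₀‖ R with hr | hr
  · exact hy (by simpa [dist_eq_norm] using hr)
  · refine le_trans (hy (show x₀ ∈ Metric.closedBall x₀ R by simpa using hRpos)) ?_
    change (τ : EReal) * f x₀ + ((1 / 2 * ‖x₀ - v‖ ^ 2 : ℝ) : EReal)
      ≤ (τ : EReal) * f w + ((1 / 2 * ‖w - v‖ ^ 2 : ℝ) : EReal)
    by_cases hw : f w = ⊤
    · rw [hw, EReal.coe_mul_top_of_pos hτ, EReal.top_add_coe]
      exact le_top
    have hlow := hKf w
    rw [← hf.coe_toReal hw] at hlow ⊢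
    rw [EReal.coe_le_coe_iff] at hlow
    rw [← hf.coe_toReal hx₀]
    norm_cast
    set r := ‖w - x₀‖ with hrdef
    have htri : r - d ≤ ‖w - v‖ := by
      have := norm_sub_le (w - v) (x₀ - v)
      rw [sub_sub_sub_cancel_right] at this
      linarith
    have hτK : 0 ≤ τ * K := by positivity
    have hτt : 0 ≤ τ * |t₀| := by positivity
    have hrd : 0 ≤ r - d := by nlinarith
    have hsq : (r - d) ^ 2 ≤ ‖w - v‖ ^ 2 := by gcongr
    have hlow' : -(τ * K * (1 + r)) ≤ τ * (f w).toReal := by nlinarith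
    have hτ4 : τ * t₀ ≤ τ * |t₀| := by gcongr
    have hkey : r ≤ r * (r / 2 - τ * K - d) := by
      have : 1 ≤ r / 2 - τ * K - d := by nlinarith
      nlinarith [norm_nonneg (w - x₀)]
    nlinarith

/-- Compare `y` with a point at fraction `t` of the segment to `w`, divide by `t` and let `t → 0`:
the quadratic remainder disappears. -/
theorem isSubgradient_of_isProx (hf : IsClosedProperConvex f) {τ : ℝ} (hτ : 0 < τ)
    {v y : EuclideanSpace ℝ (Fin n)} (h : IsProx (fun y => (τ : EReal) * f y) v y) :
    IsSubgradient f y ((1 / τ) • (v - y)) := by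
  have hy : f y ≠ ⊤ := by
    obtain ⟨x₀, hx₀⟩ := hf.ne_top
    intro hy
    have := h x₀
    simp only [hy, EReal.coe_mul_top_of_pos hτ, EReal.top_add_coe, top_le_iff] at this
    rw [← hf.coe_toReal hx₀] at this
    norm_cast at this
    exact EReal.coe_ne_top _ this
  refine ⟨hy, fun w => ?_⟩
  by_cases hw : f w = ⊤
  · simp [hw]
  rw [← hf.coe_toReal hw, ← hf.coe_toReal hy]
  norm_cast
  set a := (f y).toReal
  set b := (f w).toReal
  have key : ∀ t : ℝ, 0 < t → t < 1 →
      0 ≤ τ * (b - a) + inner ℝ (y - v) (w - y) + t * (1 / 2 * ‖w - y‖ ^ 2) := by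
    intro t ht0 ht1
    have h1 := hf.le_combination hy hw (a := 1 - t) (b := t) (by linarith) ht0.le (by ring)
    have hne : f ((1 - t) • y + t • w) ≠ ⊤ := ne_top_of_le_ne_top (EReal.coe_ne_top _) h1
    have h2 := h ((1 - t) • y + t • w)
    simp only at h2
    rw [← hf.coe_toReal hne] at h1 h2
    rw [← hf.coe_toReal hy] at h2
    norm_cast at h1 h2
    have hpt : (1 - t) • y + t • w - v = (y - v) + t • (w - y) := by module
    rw [hpt, norm_add_sq_real, inner_smul_right, norm_smul, mul_pow, Real.norm_eq_abs, sq_abs] at h2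
    have h3 : τ * (f ((1 - t) • y + t • w)).toReal ≤ τ * ((1 - t) * a + t * b) := by gcongr
    have h4 : 0 ≤ t * (τ * (b - a) + inner ℝ (y - v) (w - y) + t * (1 / 2 * ‖w - y‖ ^ 2)) := by
      nlinarith
    exact nonneg_of_mul_nonneg_right h4 ht0
  have hlim : 0 ≤ τ * (b - a) + inner ℝ (y - v) (w - y) + 0 * (1 / 2 * ‖w - y‖ ^ 2) := by
    have ht : Tendsto (fun t : ℝ =>
        τ * (b - a) + inner ℝ (y - v) (w - y) + t * (1 / 2 * ‖w - y‖ ^ 2)) (𝓝[>] 0)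
        (𝓝 (τ * (b - a) + inner ℝ (y - v) (w - y) + 0 * (1 / 2 * ‖w - y‖ ^ 2))) :=
      (Continuous.tendsto (by fun_prop) 0).mono_left nhdsWithin_le_nhds
    refine ge_of_tendsto ht ?_
    filter_upwards [Ioo_mem_nhdsGT (zero_lt_one' ℝ)] with t ht
    exact key t ht.1 ht.2
  rw [inner_smul_left]
  simp only [one_div, map_inv₀, conj_trivial]
  have hneg : inner ℝ (v - y) (w - y) = -inner ℝ (y - v) (w - y) := by
    rw [← inner_neg_left, neg_sub]
  rw [hneg]
  have : -(inner ℝ (y - v) (w - y)) ≤ τ * (b - a) := by linarith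
  have h5 : τ⁻¹ * -(inner ℝ (y - v) (w - y)) ≤ τ⁻¹ * (τ * (b - a)) := by gcongr
  rw [inv_mul_cancel_left₀ hτ.ne'] at h5
  linarith

end IsClosedProperConvex

namespace IsSubgradient

variable {f : EuclideanSpace ℝ (Fin n) → EReal} {x y w g h : EuclideanSpace ℝ (Fin n)}

theorem toReal_le (hg : IsSubgradient f x g) (hf : IsClosedProperConvex f) (hw : f w ≠ ⊤) :
    (f x).toReal + inner ℝ g (w - x) ≤ (f w).toReal := by
  have := hg.2 w
  rw [← hf.coe_toReal hw, ← hf.coe_toReal hg.1] at this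
  exact_mod_cast this

theorem inner_nonneg (hg : IsSubgradient f x g) (hh : IsSubgradient f y h)
    (hf : IsClosedProperConvex f) : 0 ≤ inner ℝ (g - h) (x - y) := by
  have h1 := hg.toReal_le hf hh.1
  have h2 := hh.toReal_le hf hg.1
  have h3 : inner ℝ g (y - x) = -inner ℝ g (x - y) := by rw [← inner_neg_right, neg_sub]
  rw [inner_sub_left]
  linarith

/-- The subgradient inequality at a point of the segment, combined with strong convexity and divided
by the parameter `b`, gives the claim as `b → 0`. -/
theorem toReal_add_sq_le (hg : IsSubgradient f x g) (hf : IsClosedProperConvex f) {μ : ℝ}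
    (hμ : IsStronglyConvex μ f) (hw : f w ≠ ⊤) :
    (f x).toReal + inner ℝ g (w - x) + μ / 2 * ‖w - x‖ ^ 2 ≤ (f w).toReal := by
  have key : ∀ b : ℝ, 0 < b → b < 1 →
      (f x).toReal + inner ℝ g (w - x) + (1 - b) * (μ / 2 * ‖w - x‖ ^ 2) ≤ (f w).toReal := by
    intro b hb0 hb1
    have h1 := hf.le_combination hg.1 hw (a := 1 - b) (b := b) (by linarith) hb0.le (by ring)
    have hne : f ((1 - b) • x + b • w) ≠ ⊤ := ne_top_of_le_ne_top (EReal.coe_ne_top _) h1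
    have h2 := hμ.2 x w (1 - b) b (by linarith) hb0 (by ring)
    have h3 := hg.toReal_le hf hne
    rw [← hf.coe_toReal hne, ← hf.coe_toReal hw, ← hf.coe_toReal hg.1] at h2
    norm_cast at h2
    have hpt : (1 - b) • x + b • w - x = b • (w - x) := by module
    rw [hpt, inner_smul_right] at h3
    rw [norm_sub_rev] at h2
    have h4 : b * ((f x).toReal + inner ℝ g (w - x) + (1 - b) * (μ / 2 * ‖w - x‖ ^ 2))
        ≤ b * (f w).toReal := by nlinarith
    exact le_of_mul_le_mul_left h4 hb0
  have ht : Tendsto (fun b : ℝ =>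
      (f x).toReal + inner ℝ g (w - x) + (1 - b) * (μ / 2 * ‖w - x‖ ^ 2)) (𝓝[>] 0)
      (𝓝 ((f x).toReal + inner ℝ g (w - x) + (1 - 0) * (μ / 2 * ‖w - x‖ ^ 2))) :=
    (Continuous.tendsto (by fun_prop) 0).mono_left nhdsWithin_le_nhds
  rw [sub_zero, one_mul] at ht
  refine le_of_tendsto ht ?_
  filter_upwards [Ioo_mem_nhdsGT (zero_lt_one' ℝ)] with b hb
  exact key b hb.1 hb.2

theorem mul_sq_le_inner (hg : IsSubgradient f x g) (hh : IsSubgradient f y h)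
    (hf : IsClosedProperConvex f) {μ : ℝ} (hμ : IsStronglyConvex μ f) :
    μ * ‖x - y‖ ^ 2 ≤ inner ℝ (g - h) (x - y) := by
  have h1 := hg.toReal_add_sq_le hf hμ hh.1
  have h2 := hh.toReal_add_sq_le hf hμ hg.1
  have h3 : inner ℝ g (y - x) = -inner ℝ g (x - y) := by rw [← inner_neg_right, neg_sub]
  rw [norm_sub_rev] at h1
  rw [inner_sub_left]
  linarith

/-- The graph of the subdifferential is closed. -/
theorem of_tendsto (hf : IsClosedProperConvex f) {ι : Type*} {l : Filter ι} [l.NeBot]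
    {u v : ι → EuclideanSpace ℝ (Fin n)} (h : ∀ k, IsSubgradient f (u k) (v k))
    (hu : Tendsto u l (𝓝 x)) (hv : Tendsto v l (𝓝 g)) : IsSubgradient f x g := by
  have key : ∀ w, f w ≠ ⊤ → f x ≤ (((f w).toReal - inner ℝ g (w - x) : ℝ) : EReal) := by
    intro w hw
    -- Solved for `f (u k)`, the subgradient inequality is membership in the epigraph, which
    -- survives the limit.
    have hmem : ∀ k, (u k, (f w).toReal - inner ℝ (v k) (w - u k)) ∈ epigraph f := by
      intro k
      change f (u k) ≤ _
      rw [← hf.coe_toReal (h k).1, EReal.coe_le_coe_iff]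
      linarith [(h k).toReal_le hf hw]
    suffices hlim : (x, (f w).toReal - inner ℝ g (w - x)) ∈ epigraph f from hlim
    refine hf.closed.mem_of_tendsto (b := l) (hu.prodMk_nhds ?_) (Eventually.of_forall hmem)
    exact tendsto_const_nhds.sub (hv.inner (tendsto_const_nhds.sub hu))
  obtain ⟨x₀, hx₀⟩ := hf.ne_top
  have hx : f x ≠ ⊤ := ne_top_of_le_ne_top (EReal.coe_ne_top _) (key x₀ hx₀)
  refine ⟨hx, fun w => ?_⟩
  by_cases hw : f w = ⊤
  · simp [hw]
  have := key w hw
  rw [← hf.coe_toReal hx] at this ⊢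
  rw [← hf.coe_toReal hw]
  norm_cast at this ⊢
  linarith

end IsSubgradient

/-- The subgradients at `y` and `y'` differ by `-(1 / τ) • (y - y')`, so monotonicity forces `y =
y'`. -/
theorem IsClosedProperConvex.isProx_unique {f : EuclideanSpace ℝ (Fin n) → EReal}
    (hf : IsClosedProperConvex f) {τ : ℝ} (hτ : 0 < τ) {v y y' : EuclideanSpace ℝ (Fin n)}
    (h : IsProx (fun y => (τ : EReal) * f y) v y) (h' : IsProx (fun y => (τ : EReal) * f y) v y') :
    y = y' := by
  have h1 := (hf.isSubgradient_of_isProx hτ h).inner_nonneg (hf.isSubgradient_of_isProx hτ h') hf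
  rw [← smul_sub, inner_smul_left, sub_sub_sub_cancel_left, ← neg_sub y y', inner_neg_left,
    real_inner_self_eq_norm_sq] at h1
  simp only [conj_trivial] at h1
  have h2 : 0 < 1 / τ := by positivity
  have h3 : ‖y - y'‖ ^ 2 ≤ 0 := by
    by_contra hc
    push Not at hc
    nlinarith [mul_pos h2 hc]
  exact sub_eq_zero.mp (norm_eq_zero.mp (pow_eq_zero_iff two_ne_zero |>.mp
    (le_antisymm h3 (by positivity))))

end

/-! ### The sweep through the colors: well-posedness, edge multipliers, optimality conditions -/

section

variable {n P C : ℕ} {G : SimpleGraph (Fin P)} [DecidableRel G.Adj]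

theorem degree_pos (hP : 2 ≤ P) (hG : G.Connected) (p : Fin P) : 0 < G.degree p := by
  have : Nontrivial (Fin P) := Fin.nontrivial_iff_two_le.mpr hP
  exact hG.preconnected.degree_pos_of_nontrivial p

theorem tau_pos (hP : 2 ≤ P) (hG : G.Connected) {ρ : ℝ} (hρ : 0 < ρ) (p : Fin P) :
    0 < tau G ρ p := by
  have : (0 : ℝ) < G.degree p := by exact_mod_cast degree_pos hP hG p
  unfold tau
  positivity

theorem neighborAverage_congr (col : G.Coloring (Fin C))
    {y y' : Fin P → EuclideanSpace ℝ (Fin n)} (xold : Fin P → EuclideanSpace ℝ (Fin n)) {p : Fin P}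
    (h : ∀ j, col j < col p → y j = y' j) :
    neighborAverage G col y xold p = neighborAverage G col y' xold p := by
  unfold neighborAverage
  congr 2
  refine Finset.sum_congr rfl fun j hj => h j (Finset.mem_filter.mp hj).2

/-- One sweep of D-ADMM through all colors is possible. -/
theorem exists_sweep (hP : 2 ≤ P) {f : Fin P → EuclideanSpace ℝ (Fin n) → EReal}
    (hf : ∀ p, IsClosedProperConvex (f p)) (hG : G.Connected) (col : G.Coloring (Fin C))
    {ρ : ℝ} (hρ : 0 < ρ) (xold γ : Fin P → EuclideanSpace ℝ (Fin n)) :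
    ∃ xnew : Fin P → EuclideanSpace ℝ (Fin n), ∀ p, IsProx (fun y => (tau G ρ p : EReal) * f p y)
      (neighborAverage G col xnew xold p - tau G ρ p • γ p) (xnew p) := by
  choose pr hpr using fun p => (hf p).exists_isProx (tau_pos hP hG hρ p)
  obtain ⟨step, hstep⟩ : ∃ step : (Fin P → EuclideanSpace ℝ (Fin n)) →
      Fin P → EuclideanSpace ℝ (Fin n), ∀ y p,
      step y p = pr p (neighborAverage G col y xold p - tau G ρ p • γ p) := ⟨_, fun _ _ => rfl⟩
  -- A sweep is a fixed point of `step`, and `step` at `p` reads only smaller colors. Hence each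
  -- application settles one more color, and `C` applications suffice.
  have stable : ∀ m : ℕ, ∀ p, (col p : ℕ) < m → step^[m + 1] 0 p = step^[m] 0 p := by
    intro m
    induction m with
    | zero => intro p hp; omega
    | succ m ih =>
      intro p hp
      rw [Function.iterate_succ_apply', hstep, neighborAverage_congr col xold fun j hj =>
        ih j (by have : (col j : ℕ) < col p := hj; omega), Function.iterate_succ_apply', hstep]
  refine ⟨step^[C] 0, fun p => ?_⟩
  have h1 := stable C p (col p).isLt
  rw [Function.iterate_succ_apply', hstep] at h1
  rw [← h1]
  exact hpr p _

theorem sweep_unique (hP : 2 ≤ P) {f : Fin P → EuclideanSpace ℝ (Fin n) → EReal}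
    (hf : ∀ p, IsClosedProperConvex (f p)) (hG : G.Connected) (col : G.Coloring (Fin C))
    {ρ : ℝ} (hρ : 0 < ρ) {xold γ y y' : Fin P → EuclideanSpace ℝ (Fin n)}
    (hy : ∀ p, IsProx (fun y => (tau G ρ p : EReal) * f p y)
      (neighborAverage G col y xold p - tau G ρ p • γ p) (y p))
    (hy' : ∀ p, IsProx (fun y => (tau G ρ p : EReal) * f p y)
      (neighborAverage G col y' xold p - tau G ρ p • γ p) (y' p)) : y = y' := by
  have key : ∀ m : ℕ, ∀ p, (col p : ℕ) < m → y p = y' p := by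
    intro m
    induction m with
    | zero => intro p hp; omega
    | succ m ih =>
      intro p hp
      have h1 := hy p
      rw [neighborAverage_congr col xold fun j hj =>
        ih j (by have : (col j : ℕ) < col p := hj; omega)] at h1
      exact (hf p).isProx_unique (tau_pos hP hG hρ p) h1 (hy' p)
  exact funext fun p => key C p (col p).isLt

theorem exists_isRun (hP : 2 ≤ P) {f : Fin P → EuclideanSpace ℝ (Fin n) → EReal}
    (hf : ∀ p, IsClosedProperConvex (f p)) (hG : G.Connected) (col : G.Coloring (Fin C))
    {ρ : ℝ} (hρ : 0 < ρ) :
    ∃ x γ : ℕ → Fin P → EuclideanSpace ℝ (Fin n), IsRun G col f ρ x γ := by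
  choose next hnext using exists_sweep hP hf hG col hρ
  let s : ℕ → (Fin P → EuclideanSpace ℝ (Fin n)) × (Fin P → EuclideanSpace ℝ (Fin n)) :=
    fun k => Nat.rec (0, 0) (fun _ u => (next u.1 u.2,
      fun p => u.2 p + ρ • ∑ j ∈ G.neighborFinset p, (next u.1 u.2 p - next u.1 u.2 j))) k
  exact ⟨fun k => (s k).1, fun k => (s k).2, fun _ => rfl, fun _ => rfl,
    fun k p => hnext (s k).1 (s k).2 p, fun _ _ => rfl⟩

theorem IsRun.unique (hP : 2 ≤ P) {f : Fin P → EuclideanSpace ℝ (Fin n) → EReal}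
    (hf : ∀ p, IsClosedProperConvex (f p)) (hG : G.Connected) {col : G.Coloring (Fin C)}
    {ρ : ℝ} (hρ : 0 < ρ) {x γ x' γ' : ℕ → Fin P → EuclideanSpace ℝ (Fin n)}
    (h : IsRun G col f ρ x γ) (h' : IsRun G col f ρ x' γ') : x' = x ∧ γ' = γ := by
  have key : ∀ k, x' k = x k ∧ γ' k = γ k := by
    intro k
    induction k with
    | zero =>
      exact ⟨funext fun p => by rw [h.init_x, h'.init_x], funext fun p => by rw [h.init_γ, h'.init_γ]⟩
    | succ k ih =>
      have hx : x' (k + 1) = x (k + 1) := by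
        refine sweep_unique hP hf hG col hρ (xold := x k) (γ := γ k) (fun p => ?_) (h.step_x k)
        rw [← ih.1, ← ih.2]
        exact h'.step_x k p
      refine ⟨hx, funext fun p => ?_⟩
      rw [h.step_γ, h'.step_γ, hx, ih.2]
  exact ⟨funext fun k => (key k).1, funext fun k => (key k).2⟩

/-- The weight of the ordered pair `(i, j)`: it is `1` if `i` and `j` are adjacent and `i` comes
before `j` in the order of the colors, and `0` otherwise. -/
def edgeWeight (col : G.Coloring (Fin C)) (i j : Fin P) : ℝ :=
  if G.Adj i j ∧ col i < col j then 1 else 0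

theorem edgeWeight_nonneg (col : G.Coloring (Fin C)) (i j : Fin P) : 0 ≤ edgeWeight col i j := by
  unfold edgeWeight
  split_ifs <;> norm_num

/-- A proper coloring gives every edge exactly one orientation. -/
theorem edgeWeight_add_edgeWeight (col : G.Coloring (Fin C)) (i j : Fin P) :
    edgeWeight col i j + edgeWeight col j i = if G.Adj i j then 1 else 0 := by
  unfold edgeWeight
  by_cases h : G.Adj i j
  · rcases lt_or_gt_of_ne (col.valid h) with h1 | h1
    · simp [h, h1, h1.not_gt]
    · simp [h, h.symm, h1, h1.not_gt]
  · have h' : ¬ G.Adj j i := fun h' => h h'.symm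
    simp [h, h']

theorem sum_neighborFinset_eq {M : Type*} [AddCommGroup M] [Module ℝ M] (col : G.Coloring (Fin C))
    (p : Fin P) (u : Fin P → M) :
    ∑ j ∈ G.neighborFinset p, u j
      = ∑ j, edgeWeight col p j • u j + ∑ j, edgeWeight col j p • u j := by
  rw [← Finset.sum_add_distrib]
  simp_rw [← add_smul, edgeWeight_add_edgeWeight, ite_smul, one_smul, zero_smul]
  rw [← Finset.sum_filter, SimpleGraph.neighborFinset_eq_filter]

/-- The multiplier of the constraint `x i = x j` after `k` iterations. -/
def multiplier (ρ : ℝ) (x : ℕ → Fin P → EuclideanSpace ℝ (Fin n)) (k : ℕ) (i j : Fin P) :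
    EuclideanSpace ℝ (Fin n) :=
  ρ • ∑ t ∈ range k, (x (t + 1) i - x (t + 1) j)

theorem multiplier_succ (ρ : ℝ) (x : ℕ → Fin P → EuclideanSpace ℝ (Fin n)) (k : ℕ) (i j : Fin P) :
    multiplier ρ x (k + 1) i j = multiplier ρ x k i j + ρ • (x (k + 1) i - x (k + 1) j) := by
  simp only [multiplier, sum_range_succ, smul_add]

theorem multiplier_swap (ρ : ℝ) (x : ℕ → Fin P → EuclideanSpace ℝ (Fin n)) (k : ℕ) (i j : Fin P) :
    multiplier ρ x k j i = -multiplier ρ x k i j := by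
  simp only [multiplier, ← smul_neg, ← Finset.sum_neg_distrib, neg_sub]

/-- The divergence at `p` of a flow `l` along the ordered edges. -/
def divergence {ι E : Type*} [Fintype ι] [AddCommGroup E] [Module ℝ E] (w : ι → ι → ℝ)
    (l : ι → ι → E) (p : ι) : E :=
  ∑ j, w p j • l p j - ∑ i, w i p • l i p

/-- The subgradient at the new iterate `x'` that the optimality conditions of a sweep provide,
where `l'` is the new multiplier and `x` the old iterate. -/
def sweepSubgradient {ι E : Type*} [Fintype ι] [AddCommGroup E] [Module ℝ E] (w : ι → ι → ℝ)
    (ρ : ℝ) (x x' : ι → E) (l' : ι → ι → E) (p : ι) : E :=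
  -(divergence w l' p + ρ • ∑ j, w p j • (x' j - x j))

/-- `γ k p` is the sum of the multipliers over all neighbors; antisymmetry turns those on incoming
edges into the negative part of the divergence. -/
theorem IsRun.γ_eq {f : Fin P → EuclideanSpace ℝ (Fin n) → EReal} {col : G.Coloring (Fin C)}
    {ρ : ℝ} {x γ : ℕ → Fin P → EuclideanSpace ℝ (Fin n)} (h : IsRun G col f ρ x γ) (k : ℕ)
    (p : Fin P) : γ k p = divergence (edgeWeight col) (multiplier ρ x k) p := by
  have key : γ k p = ∑ j ∈ G.neighborFinset p, multiplier ρ x k p j := by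
    induction k with
    | zero => simp [h.init_γ, multiplier]
    | succ k ih => simp_rw [multiplier_succ, h.step_γ, ih, sum_add_distrib, smul_sum]
  rw [key, sum_neighborFinset_eq col, divergence, sub_eq_add_neg, ← Finset.sum_neg_distrib]
  congr 1
  refine Finset.sum_congr rfl fun j _ => ?_
  rw [multiplier_swap, smul_neg]

/-- Passing from the old to the new multiplier absorbs the terms in `x (k + 1)`. Neighbors of larger
color entered with their old values, which leaves the correction on outgoing edges only. -/
theorem IsRun.isSubgradient (hP : 2 ≤ P) (hG : G.Connected)
    {f : Fin P → EuclideanSpace ℝ (Fin n) → EReal} (hf : ∀ p, IsClosedProperConvex (f p))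
    {col : G.Coloring (Fin C)} {ρ : ℝ} (hρ : 0 < ρ)
    {x γ : ℕ → Fin P → EuclideanSpace ℝ (Fin n)} (h : IsRun G col f ρ x γ) (k : ℕ) (p : Fin P) :
    IsSubgradient (f p) (x (k + 1) p)
      (sweepSubgradient (edgeWeight col) ρ (x k) (x (k + 1)) (multiplier ρ x (k + 1)) p) := by
  have hsub := (hf p).isSubgradient_of_isProx (tau_pos hP hG hρ p) (h.step_x k p)
  convert hsub using 1
  have hD : (G.degree p : ℝ) ≠ 0 := by exact_mod_cast (degree_pos hP hG p).ne'
  have hτ : 1 / tau G ρ p = ρ * G.degree p := by simp [tau]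
  have e1 : ∑ j ∈ G.neighborFinset p with col j < col p, x (k + 1) j
      = ∑ j, edgeWeight col j p • x (k + 1) j := by
    rw [SimpleGraph.neighborFinset_eq_filter, Finset.filter_filter, Finset.sum_filter]
    refine Finset.sum_congr rfl fun j _ => ?_
    simp only [edgeWeight, G.adj_comm j p, ite_smul, one_smul, zero_smul]
  have e2 : ∑ j ∈ G.neighborFinset p with col p < col j, x k j
      = ∑ j, edgeWeight col p j • x k j := by
    rw [SimpleGraph.neighborFinset_eq_filter, Finset.filter_filter, Finset.sum_filter]
    refine Finset.sum_congr rfl fun j _ => ?_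
    simp only [edgeWeight, ite_smul, one_smul, zero_smul]
  have e3 : (G.degree p : ℝ) • x (k + 1) p
      = ∑ j, edgeWeight col p j • x (k + 1) p + ∑ j, edgeWeight col j p • x (k + 1) p := by
    rw [← sum_neighborFinset_eq col, Finset.sum_const, SimpleGraph.card_neighborFinset_eq_degree,
      Nat.cast_smul_eq_nsmul]
  have e4 : (1 / tau G ρ p) • (neighborAverage G col (x (k + 1)) (x k) p - tau G ρ p • γ k p
      - x (k + 1) p) = ρ • (∑ j, edgeWeight col j p • x (k + 1) j
        + ∑ j, edgeWeight col p j • x k j) - γ k p - ρ • ((G.degree p : ℝ) • x (k + 1) p) := by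
    rw [smul_sub, smul_sub, smul_smul, one_div_mul_cancel (tau_pos hP hG hρ p).ne', one_smul, hτ,
      neighborAverage, e1, e2, mul_smul ρ, smul_smul (G.degree p : ℝ), mul_one_div_cancel hD,
      one_smul, mul_smul ρ]
  rw [e4, e3, h.γ_eq]
  simp only [sweepSubgradient, divergence, multiplier_succ, multiplier_swap ρ x k _ p]
  simp only [smul_add, smul_sub, smul_neg, sum_add_distrib, sum_sub_distrib, sum_neg_distrib,
    smul_sum, smul_comm ρ]
  abel

end

/-! ### The energy identity -/

section

section Energy

variable {ι E : Type*} [Fintype ι] [NormedAddCommGroup E]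

/-- The Lyapunov function of the method, for multipliers `l` and iterates `x`. -/
noncomputable def energy (w : ι → ι → ℝ) (ρ : ℝ) (l : ι → ι → E) (x : ι → E) : ℝ :=
  ∑ i, ∑ j, w i j * (1 / (2 * ρ) * ‖l i j‖ ^ 2 + ρ / 2 * ‖x j‖ ^ 2)

theorem energy_nonneg {w : ι → ι → ℝ} (hw : ∀ i j, 0 ≤ w i j) {ρ : ℝ} (hρ : 0 < ρ)
    (l : ι → ι → E) (x : ι → E) : 0 ≤ energy w ρ l x :=
  sum_nonneg fun i _ => sum_nonneg fun j _ => mul_nonneg (hw i j) (by positivity)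

theorem mul_le_energy {w : ι → ι → ℝ} (hw : ∀ i j, 0 ≤ w i j) {ρ : ℝ} (hρ : 0 < ρ)
    (l : ι → ι → E) (x : ι → E) (i j : ι) :
    w i j * (1 / (2 * ρ) * ‖l i j‖ ^ 2 + ρ / 2 * ‖x j‖ ^ 2) ≤ energy w ρ l x := by
  have h0 : ∀ i j, 0 ≤ w i j * (1 / (2 * ρ) * ‖l i j‖ ^ 2 + ρ / 2 * ‖x j‖ ^ 2) :=
    fun i j => mul_nonneg (hw i j) (by positivity)
  exact (single_le_sum (f := fun j => w i j * (1 / (2 * ρ) * ‖l i j‖ ^ 2 + ρ / 2 * ‖x j‖ ^ 2))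
    (fun j _ => h0 i j) (mem_univ j)).trans
    (single_le_sum (f := fun i => ∑ j, w i j * (1 / (2 * ρ) * ‖l i j‖ ^ 2 + ρ / 2 * ‖x j‖ ^ 2))
      (fun i _ => sum_nonneg fun j _ => h0 i j) (mem_univ i))

variable [InnerProductSpace ℝ E]

theorem sum_inner_divergence (w : ι → ι → ℝ) (l : ι → ι → E) (y : ι → E) :
    ∑ p, inner ℝ (divergence w l p) (y p) = ∑ i, ∑ j, w i j * inner ℝ (l i j) (y i - y j) := by
  simp only [divergence, inner_sub_left, sum_inner, inner_smul_left, inner_sub_right, mul_sub,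
    sum_sub_distrib, conj_trivial]
  congr 1
  exact sum_comm

theorem sum_divergence (w : ι → ι → ℝ) (l : ι → ι → E) : ∑ p, divergence w l p = 0 := by
  simp only [divergence, sum_sub_distrib]
  rw [sub_eq_zero]
  exact sum_comm

theorem divergence_sub (w : ι → ι → ℝ) (l m : ι → ι → E) :
    divergence w (l - m) = divergence w l - divergence w m := by
  funext p
  simp only [divergence, Pi.sub_apply, smul_sub, sum_sub_distrib]
  abel

theorem sweepSubgradient_sub (w : ι → ι → ℝ) (ρ : ℝ) (x x' y y' : ι → E) (l m : ι → ι → E) (p : ι) :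
    sweepSubgradient w ρ (x - y) (x' - y') (l - m) p
      = sweepSubgradient w ρ x x' l p - sweepSubgradient w ρ y y' m p := by
  simp only [sweepSubgradient, divergence_sub, Pi.sub_apply, smul_sub, sum_sub_distrib]
  abel

theorem sweepSubgradient_self (w : ι → ι → ℝ) (ρ : ℝ) (x : ι → E) (l : ι → ι → E) (p : ι) :
    sweepSubgradient w ρ x x l p = -divergence w l p := by
  simp [sweepSubgradient]

/-- Summation by parts turns the pairing into a sum over oriented edges; the identity then holds
edge by edge, by expanding squares. Only the linear multiplier update is assumed, so it applies both
to increments and to deviations from a saddle point. -/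
theorem energy_identity (w : ι → ι → ℝ) {ρ : ℝ} (hρ : 0 < ρ) {x x' : ι → E} {l l' : ι → ι → E}
    (hl : ∀ i j, l' i j = l i j + ρ • (x' i - x' j)) :
    energy w ρ l' x' + (ρ / 2 * ∑ i, ∑ j, w i j * ‖x' i - x j‖ ^ 2
      + ∑ p, inner ℝ (sweepSubgradient w ρ x x' l' p) (x' p)) = energy w ρ l x := by
  have h1 : ∑ p, inner ℝ (sweepSubgradient w ρ x x' l' p) (x' p)
      = -∑ i, ∑ j, w i j * (inner ℝ (l' i j) (x' i - x' j) + ρ * inner ℝ (x' j - x j) (x' i)) := by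
    simp only [sweepSubgradient, inner_neg_left, inner_add_left, sum_neg_distrib, sum_add_distrib,
      sum_inner_divergence, mul_add, inner_smul_left, sum_inner, conj_trivial, mul_sum]
    congr 2
    exact sum_congr rfl fun i _ => sum_congr rfl fun j _ => by ring
  rw [h1, mul_sum, ← sub_eq_add_neg, energy, energy, ← sum_sub_distrib, ← sum_add_distrib]
  refine sum_congr rfl fun i _ => ?_
  rw [mul_sum, ← sum_sub_distrib, ← sum_add_distrib]
  refine sum_congr rfl fun j _ => ?_
  have e1 : l i j = l' i j - ρ • (x' i - x' j) := by rw [hl]; abel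
  have e2 : x' i - x j = (x' i - x' j) + (x' j - x j) := by abel
  have e3 : ‖x j‖ ^ 2 = ‖x' j - (x' j - x j)‖ ^ 2 := by congr 2; abel
  have e4 : inner ℝ (x' j - x j) (x' i)
      = inner ℝ (x' i - x' j) (x' j - x j) + inner ℝ (x' j) (x' j - x j) := by
    rw [← inner_add_left, sub_add_cancel, real_inner_comm]
  rw [e1, e2, e3, e4, norm_sub_sq_real (l' i j), norm_sub_sq_real (x' j), norm_add_sq_real,
    inner_smul_right, norm_smul, mul_pow, Real.norm_eq_abs, sq_abs]
  field_simp
  ring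

end Energy

theorem summable_of_descent {U c : ℕ → ℝ} (hU : ∀ k, 0 ≤ U k) (hc : ∀ k, 0 ≤ c k)
    (h : ∀ k, U (k + 1) + c k = U k) : Summable c := by
  refine summable_of_sum_range_le (c := U 0) hc fun K => ?_
  have : ∑ k ∈ range K, c k = U 0 - U K := by
    induction K with
    | zero => simp
    | succ K ih => rw [sum_range_succ, ih]; linarith [h K]
  linarith [hU K]

section Run

variable {n P C : ℕ} {G : SimpleGraph (Fin P)} [DecidableRel G.Adj]
  {f : Fin P → EuclideanSpace ℝ (Fin n) → EReal} {col : G.Coloring (Fin C)} {ρ : ℝ}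
  {x γ : ℕ → Fin P → EuclideanSpace ℝ (Fin n)}

/-- The subgradients `sweepSubgradient` along a sequence of iterates; the `k`-th one belongs to
`x (k + 1)`. -/
def iterateSubgradient (col : G.Coloring (Fin C)) (ρ : ℝ)
    (x : ℕ → Fin P → EuclideanSpace ℝ (Fin n)) (k : ℕ) (p : Fin P) : EuclideanSpace ℝ (Fin n) :=
  sweepSubgradient (edgeWeight col) ρ (x k) (x (k + 1)) (multiplier ρ x (k + 1)) p

/-- The energy identity for increments of iterates and multipliers needs no saddle point: the
pairings are nonnegative by monotonicity and their sum telescopes. -/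
theorem IsRun.summable_inner_sub (hP : 2 ≤ P) (hG : G.Connected)
    (hf : ∀ p, IsClosedProperConvex (f p)) (hρ : 0 < ρ) (h : IsRun G col f ρ x γ) (p : Fin P) :
    Summable fun k => inner ℝ (iterateSubgradient col ρ x (k + 1) p - iterateSubgradient col ρ x k p)
      (x (k + 2) p - x (k + 1) p) := by
  have hnn : ∀ k p, 0 ≤ inner ℝ
      (iterateSubgradient col ρ x (k + 1) p - iterateSubgradient col ρ x k p)
      (x (k + 2) p - x (k + 1) p) := fun k p =>
    (h.isSubgradient hP hG hf hρ (k + 1) p).inner_nonneg (h.isSubgradient hP hG hf hρ k p) (hf p)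
  have hw := edgeWeight_nonneg col
  have hstep := fun k => energy_identity (edgeWeight col) hρ
    (x := x (k + 1) - x k) (x' := x (k + 2) - x (k + 1))
    (l := multiplier ρ x (k + 1) - multiplier ρ x k)
    (l' := multiplier ρ x (k + 2) - multiplier ρ x (k + 1)) (fun i j => by
      simp only [Pi.sub_apply, multiplier_succ]
      module)
  simp only [sweepSubgradient_sub] at hstep
  have hq : ∀ k, 0 ≤ ρ / 2 * ∑ i, ∑ j, edgeWeight col i j
      * ‖(x (k + 2) - x (k + 1)) i - (x (k + 1) - x k) j‖ ^ 2 := fun k =>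
    mul_nonneg (by positivity)
      (sum_nonneg fun i _ => sum_nonneg fun j _ => mul_nonneg (hw i j) (by positivity))
  have hsum := summable_of_descent
    (U := fun k => energy (edgeWeight col) ρ (multiplier ρ x (k + 1) - multiplier ρ x k)
      (x (k + 1) - x k))
    (fun k => energy_nonneg hw hρ _ _)
    (fun k => add_nonneg (hq k) (sum_nonneg fun p _ => hnn k p)) hstep
  refine hsum.of_nonneg_of_le (fun k => hnn k p) fun k => ?_
  have h1 := single_le_sum (f := fun p => inner ℝ
      (iterateSubgradient col ρ x (k + 1) p - iterateSubgradient col ρ x k p)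
      (x (k + 2) p - x (k + 1) p)) (fun p _ => hnn k p) (mem_univ p)
  exact h1.trans (le_add_of_nonneg_left (hq k))

end Run

end

/-! ### Convergence from a saddle point -/

section

theorem ereal_sum_ne_bot {ι : Type*} {s : Finset ι} {a : ι → EReal} (h : ∀ i, a i ≠ ⊥) :
    ∑ i ∈ s, a i ≠ ⊥ := by
  classical
  induction s using Finset.induction_on with
  | empty => simp
  | insert i s hi ih =>
    rw [sum_insert hi]
    exact EReal.add_ne_bot_iff.mpr ⟨h i, ih⟩

theorem ereal_ne_top_of_sum_ne_top {ι : Type*} [Fintype ι] {a : ι → EReal} (h : ∀ i, a i ≠ ⊥)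
    (hs : ∑ i, a i ≠ ⊤) (i : ι) : a i ≠ ⊤ := by
  classical
  intro hi
  rw [← add_sum_erase univ a (mem_univ i), hi,
    EReal.top_add_of_ne_bot (ereal_sum_ne_bot h)] at hs
  exact hs rfl

theorem coe_sum_toReal {ι : Type*} [Fintype ι] {a : ι → EReal} (h : ∀ i, a i ≠ ⊥)
    (h' : ∀ i, a i ≠ ⊤) : ((∑ i, (a i).toReal : ℝ) : EReal) = ∑ i, a i := by
  classical
  have key : ∀ s : Finset ι, ((∑ i ∈ s, (a i).toReal : ℝ) : EReal) = ∑ i ∈ s, a i := by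
    intro s
    induction s using Finset.induction_on with
    | empty => simp
    | insert i s hi ih =>
      rw [sum_insert hi, sum_insert hi, EReal.coe_add, ih, EReal.coe_toReal (h' i) (h i)]
  exact key univ

theorem sum_le_edgeOptimalValue {n P : ℕ} {G : SimpleGraph (Fin P)}
    {f : Fin P → EuclideanSpace ℝ (Fin n) → EReal} {xs : EuclideanSpace ℝ (Fin n)}
    (hG : G.Connected) (h : IsSolution f xs) :
    ∑ p, f p xs ≤ edgeOptimalValue G f := by
  refine le_iInf fun y => ?_
  obtain ⟨p₀⟩ := hG.nonempty
  have hconst : ∀ p, y.1 p = y.1 p₀ := by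
    intro p
    obtain ⟨walk⟩ := hG.preconnected p p₀
    induction walk with
    | nil => rfl
    | cons hadj _ ih => exact (y.2 _ _ hadj).trans ih
  simp_rw [hconst]
  exact h.2 _

theorem tendsto_sub_of_adj {n P C : ℕ} {G : SimpleGraph (Fin P)} {col : G.Coloring (Fin C)}
    {x : ℕ → Fin P → EuclideanSpace ℝ (Fin n)} (hG : G.Connected)
    (h : ∀ i j, G.Adj i j → col i < col j → Tendsto (fun k => x k i - x k j) atTop (𝓝 0))
    (i j : Fin P) : Tendsto (fun k => x k i - x k j) atTop (𝓝 0) := by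
  obtain ⟨walk⟩ := hG.preconnected i j
  induction walk with
  | nil => simp
  | @cons i j l hadj _ ih =>
    have hij : Tendsto (fun k => x k i - x k j) atTop (𝓝 0) := by
      rcases lt_or_gt_of_ne (col.valid hadj) with hc | hc
      · exact h i j hadj hc
      · simpa using (h j i hadj.symm hc).neg
    simpa using hij.add ih

variable {n P C : ℕ} {G : SimpleGraph (Fin P)} [DecidableRel G.Adj]
  {f : Fin P → EuclideanSpace ℝ (Fin n) → EReal} {col : G.Coloring (Fin C)} {ρ : ℝ}
  {x γ : ℕ → Fin P → EuclideanSpace ℝ (Fin n)} {xs : EuclideanSpace ℝ (Fin n)}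
  {Λ : Fin P → Fin P → EuclideanSpace ℝ (Fin n)}

theorem IsSolution.ne_top (hf : ∀ p, IsClosedProperConvex (f p)) (h : IsSolution f xs)
    (p : Fin P) : f p xs ≠ ⊤ :=
  ereal_ne_top_of_sum_ne_top (fun p => (hf p).ne_bot xs) h.1 p

/-- The optimality conditions of the edge-based reformulation. -/
def IsSaddle (col : G.Coloring (Fin C)) (f : Fin P → EuclideanSpace ℝ (Fin n) → EReal)
    (xs : EuclideanSpace ℝ (Fin n)) (Λ : Fin P → Fin P → EuclideanSpace ℝ (Fin n)) : Prop :=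
  ∀ p, IsSubgradient (f p) xs (-divergence (edgeWeight col) Λ p)

/-- Divergences sum to zero, so the subgradient inequalities add up to optimality. -/
theorem IsSaddle.isSolution (hf : ∀ p, IsClosedProperConvex (f p)) (h : IsSaddle col f xs Λ) :
    IsSolution f xs := by
  have hsum := coe_sum_toReal (fun p => (hf p).ne_bot xs) (fun p => (h p).1)
  refine ⟨by rw [← hsum]; exact EReal.coe_ne_top _, fun y => ?_⟩
  by_cases hy : ∑ p, f p y = ⊤
  · rw [hy]
    exact le_top
  have hy' := ereal_ne_top_of_sum_ne_top (fun p => (hf p).ne_bot y) hy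
  rw [← hsum, ← coe_sum_toReal (fun p => (hf p).ne_bot y) hy', EReal.coe_le_coe_iff]
  have h1 := sum_le_sum fun p (_ : p ∈ univ) => (h p).toReal_le (hf p) (hy' p)
  rw [sum_add_distrib, ← sum_inner, sum_neg_distrib, sum_divergence, neg_zero, inner_zero_left,
    add_zero] at h1
  exact h1

/-- Both sides count each edge once, oriented by index or by color; after symmetrization the weights
agree. -/
theorem sum_lt_neighbor_eq_sum_edgeWeight (col : G.Coloring (Fin C)) {φ : Fin P → Fin P → ℝ}
    (hφ : ∀ i j, φ i j = φ j i) :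
    ∑ i, ∑ j ∈ G.neighborFinset i with i < j, φ i j = ∑ i, ∑ j, edgeWeight col i j * φ i j := by
  have h1 : ∀ i, ∑ j ∈ G.neighborFinset i with i < j, φ i j
      = ∑ j, (if G.Adj i j ∧ i < j then 1 else 0) * φ i j := by
    intro i
    rw [SimpleGraph.neighborFinset_eq_filter, filter_filter, sum_filter]
    exact sum_congr rfl fun j _ => by rw [ite_mul, one_mul, zero_mul]
  simp_rw [h1]
  have sym : ∀ a : Fin P → Fin P → ℝ, 2 * ∑ i, ∑ j, a i j * φ i j
      = ∑ i, ∑ j, (a i j + a j i) * φ i j := by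
    intro a
    have : ∑ i, ∑ j, a j i * φ i j = ∑ i, ∑ j, a i j * φ i j := by
      rw [sum_comm]
      exact sum_congr rfl fun i _ => sum_congr rfl fun j _ => by rw [hφ]
    simp only [add_mul, sum_add_distrib, this]
    ring
  refine mul_left_cancel₀ (two_ne_zero (α := ℝ)) ?_
  rw [sym, sym]
  refine sum_congr rfl fun i _ => sum_congr rfl fun j _ => ?_
  rw [edgeWeight_add_edgeWeight]
  congr 1
  by_cases h : G.Adj i j
  · rcases lt_or_gt_of_ne h.ne with h2 | h2
    · simp [h, h2, h2.not_gt]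
    · simp [h, h.symm, h2, h2.not_gt]
  · have h' : ¬ G.Adj j i := fun h' => h h'.symm
    simp [h, h']

/-- By strong duality the constant configuration `xs` minimizes the Lagrangian; varying the block of
a single node gives the subgradient condition there. -/
theorem StrongDuality.exists_isSaddle (hf : ∀ p, IsClosedProperConvex (f p)) (hG : G.Connected)
    (col : G.Coloring (Fin C)) (hxs : IsSolution f xs) (h : StrongDuality G f) :
    ∃ Λ, IsSaddle col f xs Λ := by
  obtain ⟨lam, hlam⟩ := h
  -- The antisymmetric extension allows the change from index orientation to color orientation.
  refine ⟨fun i j => if i < j then lam i j else -lam j i, fun p => ⟨hxs.ne_top hf p, fun y => ?_⟩⟩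
  set Λ : Fin P → Fin P → EuclideanSpace ℝ (Fin n) :=
    fun i j => if i < j then lam i j else -lam j i with hΛ
  by_cases hy : f p y = ⊤
  · rw [hy]
    exact le_top
  let X : Fin P → EuclideanSpace ℝ (Fin n) := Function.update (fun _ => xs) p y
  have hX : ∀ q, f q (X q) ≠ ⊤ := by
    intro q
    by_cases hq : q = p
    · subst hq
      simpa [X] using hy
    · simpa [X, hq] using hxs.ne_top hf q
  have h1 : ∑ q, f q xs ≤ lagrangian G f X lam :=
    (sum_le_edgeOptimalValue hG hxs).trans (hlam.symm.le.trans (iInf_le _ X))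
  have h2 : ∑ i, ∑ j ∈ G.neighborFinset i with i < j, inner ℝ (lam i j) (X i - X j)
      = inner ℝ (divergence (edgeWeight col) Λ p) (y - xs) := by
    have e1 : ∑ i, ∑ j ∈ G.neighborFinset i with i < j, inner ℝ (lam i j) (X i - X j)
        = ∑ i, ∑ j ∈ G.neighborFinset i with i < j, inner ℝ (Λ i j) (X i - X j) := by
      refine sum_congr rfl fun i _ => sum_congr rfl fun j hj => ?_
      simp [hΛ, (mem_filter.mp hj).2]
    have e2 : ∀ i j, inner ℝ (Λ i j) (X i - X j) = inner ℝ (Λ j i) (X j - X i) := by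
      intro i j
      rcases lt_trichotomy i j with hij | hij | hij
      · simp only [hΛ, hij, hij.not_gt, if_true, if_false]
        rw [inner_neg_left, ← inner_neg_right, neg_sub]
      · rw [hij]
      · simp only [hΛ, hij, hij.not_gt, if_true, if_false]
        rw [inner_neg_left, ← inner_neg_right, neg_sub]
    rw [e1, sum_lt_neighbor_eq_sum_edgeWeight col e2, ← sum_inner_divergence]
    -- Since divergences sum to zero, `xs` may be subtracted everywhere, and only node `p`
    -- contributes.
    have e3 : ∑ q, inner ℝ (divergence (edgeWeight col) Λ q) (X q)
        = ∑ q, inner ℝ (divergence (edgeWeight col) Λ q) (X q - xs) := by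
      simp_rw [inner_sub_right, sum_sub_distrib, ← sum_inner, sum_divergence]
      simp
    rw [e3, sum_eq_single p]
    · simp [X]
    · intro q _ hq
      simp [X, hq]
    · simp
  rw [lagrangian, h2, ← coe_sum_toReal (fun q => (hf q).ne_bot _) hX,
    ← coe_sum_toReal (fun q => (hf q).ne_bot _) (hxs.ne_top hf)] at h1
  norm_cast at h1
  rw [← (hf p).coe_toReal hy, ← (hf p).coe_toReal (hxs.ne_top hf p)]
  norm_cast
  rw [← add_sum_erase univ _ (mem_univ p), ← add_sum_erase univ (fun q => (f q (X q)).toReal)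
    (mem_univ p)] at h1
  have h3 : ∑ q ∈ univ.erase p, (f q (X q)).toReal = ∑ q ∈ univ.erase p, (f q xs).toReal :=
    sum_congr rfl fun q hq => by simp [X, ne_of_mem_erase hq]
  have h4 : X p = y := by simp [X]
  rw [h3, h4] at h1
  rw [inner_neg_left]
  linarith

theorem edgeWeight_eq_one {i j : Fin P} (h : G.Adj i j) (hij : col i < col j) :
    edgeWeight col i j = 1 := by simp [edgeWeight, h, hij]

theorem edgeWeight_eq_zero {i j : Fin P} (h : ¬ (G.Adj i j ∧ col i < col j)) :
    edgeWeight col i j = 0 := by simp [edgeWeight, h]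

theorem IsRun.exists_energy_step (hP : 2 ≤ P) (hG : G.Connected)
    (hf : ∀ p, IsClosedProperConvex (f p)) (hρ : 0 < ρ) (h : IsRun G col f ρ x γ)
    (hs : IsSaddle col f xs Λ) : ∃ c : ℕ → ℝ,
      (∀ k i j, G.Adj i j → col i < col j → ρ / 2 * ‖x (k + 1) i - x k j‖ ^ 2 ≤ c k) ∧
      ∀ k, energy (edgeWeight col) ρ (multiplier ρ x (k + 1) - Λ) (x (k + 1) - Function.const (Fin P) xs) + c k
        = energy (edgeWeight col) ρ (multiplier ρ x k - Λ) (x k - Function.const (Fin P) xs) := by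
  -- The decrease `c` is read off from the energy identity for the deviations from the saddle point.
  refine ⟨_, ?_, fun k => energy_identity (edgeWeight col) hρ fun i j => ?_⟩
  · intro k i j hadj hij
    have h1 : 0 ≤ ∑ p, inner ℝ (sweepSubgradient (edgeWeight col) ρ (x k - Function.const (Fin P) xs)
        (x (k + 1) - Function.const (Fin P) xs) (multiplier ρ x (k + 1) - Λ) p) ((x (k + 1) - Function.const (Fin P) xs) p) := by
      refine sum_nonneg fun p _ => ?_
      rw [sweepSubgradient_sub, sweepSubgradient_self]
      exact (h.isSubgradient hP hG hf hρ k p).inner_nonneg (hs p) (hf p)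
    refine le_trans ?_ (le_add_of_nonneg_right h1)
    have h0 : ∀ i j, 0 ≤ edgeWeight col i j
        * ‖(x (k + 1) - Function.const (Fin P) xs) i - (x k - Function.const (Fin P) xs) j‖ ^ 2 :=
      fun i j => mul_nonneg (edgeWeight_nonneg col i j) (by positivity)
    refine mul_le_mul_of_nonneg_left ?_ (by positivity)
    refine le_trans ?_ (single_le_sum (f := fun i => ∑ j, edgeWeight col i j
      * ‖(x (k + 1) - Function.const (Fin P) xs) i - (x k - Function.const (Fin P) xs) j‖ ^ 2)
      (fun i _ => sum_nonneg fun j _ => h0 i j) (mem_univ i))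
    refine le_trans ?_ (single_le_sum (fun j _ => h0 i j) (mem_univ j))
    rw [edgeWeight_eq_one hadj hij, one_mul]
    simp
  · simp only [Pi.sub_apply, Function.const_apply, multiplier_succ]
    module

theorem IsRun.tendsto_residual (hP : 2 ≤ P) (hG : G.Connected)
    (hf : ∀ p, IsClosedProperConvex (f p)) (hρ : 0 < ρ) (h : IsRun G col f ρ x γ)
    (hs : IsSaddle col f xs Λ) {i j : Fin P} (hadj : G.Adj i j) (hij : col i < col j) :
    Tendsto (fun k => x (k + 1) i - x k j) atTop (𝓝 0) := by
  obtain ⟨c, hc, hstep⟩ := h.exists_energy_step hP hG hf hρ hs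
  have hc0 : ∀ k, 0 ≤ c k := fun k => le_trans (by positivity) (hc k i j hadj hij)
  have hlim := (summable_of_descent (U := fun k => energy (edgeWeight col) ρ
    (multiplier ρ x k - Λ) (x k - Function.const (Fin P) xs))
    (fun k => energy_nonneg (edgeWeight_nonneg col) hρ _ _) hc0 hstep).tendsto_atTop_zero
  have h1 : Tendsto (fun k => ‖x (k + 1) i - x k j‖ ^ 2) atTop (𝓝 0) := by
    refine squeeze_zero (fun k => by positivity) (fun k => ?_)
      (by simpa using hlim.const_mul (2 / ρ))
    calc ‖x (k + 1) i - x k j‖ ^ 2 = 2 / ρ * (ρ / 2 * ‖x (k + 1) i - x k j‖ ^ 2) := by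
          field_simp
      _ ≤ 2 / ρ * c k := by
          have := hc k i j hadj hij
          gcongr
  rw [tendsto_zero_iff_norm_tendsto_zero]
  have := h1.sqrt
  simpa using this

theorem tendsto_zero_of_sq_le {E : Type*} [NormedAddCommGroup E] {d : ℕ → E} {b : ℕ → ℝ}
    (h : ∀ k, ‖d k‖ ^ 2 ≤ b k) (hb : Tendsto b atTop (𝓝 0)) : Tendsto d atTop (𝓝 0) := by
  rw [tendsto_zero_iff_norm_tendsto_zero]
  have := (squeeze_zero (fun k => by positivity) h hb).sqrt
  simpa using this

/-- The increments vanish at a node that is updated before all of its neighbors. -/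
theorem IsRun.tendsto_increment_of_first (hP : 2 ≤ P) (hG : G.Connected)
    (hf : ∀ p, IsClosedProperConvex (f p)) (hρ : 0 < ρ) (h : IsRun G col f ρ x γ)
    (hs : IsSaddle col f xs Λ) {p : Fin P} (hp : ∀ j, col p ≤ col j) :
    Tendsto (fun k => x (k + 1) p - x k p) atTop (𝓝 0) := by
  rw [← tendsto_add_atTop_iff_nat 1]
  set D : ℝ := ∑ j, edgeWeight col p j with hD
  have hin : ∀ j, edgeWeight col j p = 0 := fun j =>
    edgeWeight_eq_zero fun hj => absurd hj.2 (hp j).not_gt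
  have hDpos : 0 < D := by
    have h1 : D = (G.degree p : ℝ) := by
      have h2 := sum_neighborFinset_eq col p fun _ => (1 : ℝ)
      simp only [hin, sum_const_zero, add_zero, smul_eq_mul, mul_one, sum_const,
        SimpleGraph.card_neighborFinset_eq_degree, nsmul_eq_mul] at h2
      exact h2.symm
    rw [h1]
    exact_mod_cast degree_pos hP hG p
  -- With no incoming edges, the subgradient increment is `ρ • (D • d - ε)`, where `d` is the
  -- increment of the iterate and `ε` consists of edge residuals.
  set ε : ℕ → EuclideanSpace ℝ (Fin n) := fun k =>
    ∑ j, edgeWeight col p j • ((2 : ℝ) • (x (k + 2) p - x (k + 1) j) - (x (k + 1) p - x k j))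
    with hε
  have hεlim : Tendsto ε atTop (𝓝 0) := by
    rw [← sum_const_zero (s := univ) (ι := Fin P)]
    refine tendsto_finsetSum _ fun j _ => ?_
    by_cases hj : G.Adj p j ∧ col p < col j
    · have hr := h.tendsto_residual hP hG hf hρ hs hj.1 hj.2
      have hr' := (tendsto_add_atTop_iff_nat 1).mpr hr
      simpa using ((hr'.const_smul (2 : ℝ)).sub hr).const_smul (edgeWeight col p j)
    · simp [edgeWeight_eq_zero hj]
  have hg : ∀ k, iterateSubgradient col ρ x (k + 1) p - iterateSubgradient col ρ x k p
      = ρ • (D • (x (k + 2) p - x (k + 1) p) - ε k) := by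
    intro k
    simp only [iterateSubgradient, sweepSubgradient, divergence, hin, zero_smul, sum_const_zero,
      sub_zero, multiplier_succ ρ x (k + 1), hD, hε, sum_smul, smul_sum, ← sum_add_distrib,
      ← sum_sub_distrib, ← sum_neg_distrib]
    refine sum_congr rfl fun j _ => ?_
    module
  have hsum := (h.summable_inner_sub hP hG hf hρ p).tendsto_atTop_zero
  -- The pairing over `ρ` is `D * ‖d‖ ^ 2` minus the inner product of `ε` and `d`; expanding `‖D • d
  -- - ε‖ ^ 2 ≥ 0` absorbs the cross term.
  refine tendsto_zero_of_sq_le (b := fun k => 2 / D * (inner ℝ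
    (iterateSubgradient col ρ x (k + 1) p - iterateSubgradient col ρ x k p)
    (x (k + 2) p - x (k + 1) p) / ρ + ‖ε k‖ ^ 2 / (2 * D))) (fun k => ?_) ?_
  · rw [hg, inner_smul_left, inner_sub_left, inner_smul_left, real_inner_self_eq_norm_sq]
    simp only [conj_trivial]
    rw [mul_div_cancel_left₀ _ hρ.ne', ← sub_nonneg]
    set d := x (k + 2) p - x (k + 1) p
    have hsq : 0 ≤ ‖D • d - ε k‖ ^ 2 / D ^ 2 := by positivity
    rw [norm_sub_sq_real, norm_smul, inner_smul_left, mul_pow, Real.norm_eq_abs, sq_abs] at hsq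
    simp only [conj_trivial] at hsq
    refine hsq.trans_eq ?_
    rw [real_inner_comm]
    field_simp
    ring
  · simpa using ((hsum.div_const ρ).add ((hεlim.norm.pow 2).div_const (2 * D))).const_mul (2 / D)

/-- Two successive residuals of an edge differ by an increment at one end minus an earlier or later
increment at the other. Vanishing increments thus spread along walks from a node of least color. -/
theorem IsRun.tendsto_increment (hP : 2 ≤ P) (hG : G.Connected)
    (hf : ∀ p, IsClosedProperConvex (f p)) (hρ : 0 < ρ) (h : IsRun G col f ρ x γ)
    (hs : IsSaddle col f xs Λ) (q : Fin P) :
    Tendsto (fun k => x (k + 1) q - x k q) atTop (𝓝 0) := by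
  have := hG.nonempty
  obtain ⟨p, hp⟩ := Finite.exists_min col
  have hpq : Tendsto (fun k => x (k + 1) p - x k p) atTop (𝓝 0) :=
    h.tendsto_increment_of_first hP hG hf hρ hs hp
  obtain ⟨walk⟩ := hG.preconnected q p
  clear hp
  induction walk with
  | nil => exact hpq
  | @cons i j _ hadj _ ih =>
    have hj := ih hpq
    rcases lt_or_gt_of_ne (col.valid hadj) with hij | hij
    · have hr := h.tendsto_residual hP hG hf hρ hs hadj hij
      have hr' := (tendsto_add_atTop_iff_nat 1).mpr hr
      rw [← tendsto_add_atTop_iff_nat 1]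
      have := (hr'.add hj).sub hr
      simp only [add_zero, sub_zero] at this
      refine this.congr fun k => ?_
      abel
    · have hr := h.tendsto_residual hP hG hf hρ hs hadj.symm hij
      have hr' := (tendsto_add_atTop_iff_nat 1).mpr hr
      have := ((tendsto_add_atTop_iff_nat 1).mpr hj).sub (hr'.sub hr)
      simp only [sub_zero] at this
      refine this.congr fun k => ?_
      abel

theorem IsRun.tendsto_sub (hP : 2 ≤ P) (hG : G.Connected)
    (hf : ∀ p, IsClosedProperConvex (f p)) (hρ : 0 < ρ) (h : IsRun G col f ρ x γ)
    (hs : IsSaddle col f xs Λ) (i j : Fin P) :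
    Tendsto (fun k => x k i - x k j) atTop (𝓝 0) := by
  refine tendsto_sub_of_adj (col := col) hG (fun i j hadj hij => ?_) i j
  rw [← tendsto_add_atTop_iff_nat 1]
  have := (h.tendsto_residual hP hG hf hρ hs hadj hij).sub (h.tendsto_increment hP hG hf hρ hs j)
  simpa using this

theorem exists_edge (hP : 2 ≤ P) (hG : G.Connected) (col : G.Coloring (Fin C)) :
    ∃ i j, G.Adj i j ∧ col i < col j := by
  have hd := degree_pos hP hG ⟨0, by omega⟩
  obtain ⟨j, hj⟩ := (G.degree_pos_iff_exists_adj _).mp hd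
  rcases lt_or_gt_of_ne (col.valid hj) with h | h
  · exact ⟨_, _, hj, h⟩
  · exact ⟨_, _, hj.symm, h⟩

/-- D-ADMM converges, for any number of colors and any `ρ > 0`, if the optimality conditions of the
edge-based reformulation are solvable. -/
theorem IsRun.exists_tendsto_of_isSaddle (hP : 2 ≤ P) (hG : G.Connected)
    (hf : ∀ p, IsClosedProperConvex (f p)) (hρ : 0 < ρ) (h : IsRun G col f ρ x γ)
    (hs : IsSaddle col f xs Λ) :
    ∃ y, IsSolution f y ∧ ∀ p, Tendsto (fun k => x k p) atTop (𝓝 y) := by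
  have hanti : ∀ {y Γ}, IsSaddle col f y Γ → Antitone fun k =>
      energy (edgeWeight col) ρ (multiplier ρ x k - Γ) (x k - Function.const (Fin P) y) := by
    intro y Γ hy
    obtain ⟨c, hc, hstep⟩ := h.exists_energy_step hP hG hf hρ hy
    obtain ⟨i, j, hadj, hij⟩ := exists_edge hP hG col
    refine antitone_nat_of_succ_le fun k => ?_
    have : 0 ≤ c k := le_trans (by positivity) (hc k i j hadj hij)
    linarith [hstep k]
  obtain ⟨i₀, j₀, hadj₀, hij₀⟩ := exists_edge hP hG col
  set U := energy (edgeWeight col) ρ (multiplier ρ x 0 - Λ) (x 0 - Function.const (Fin P) xs) with hU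
  have hbound : ∀ k i j, G.Adj i j → col i < col j →
      1 / (2 * ρ) * ‖multiplier ρ x k i j - Λ i j‖ ^ 2 + ρ / 2 * ‖x k j - xs‖ ^ 2 ≤ U := by
    intro k i j hadj hij
    have := (mul_le_energy (edgeWeight_nonneg col) hρ (multiplier ρ x k - Λ) (x k - Function.const (Fin P) xs)
      i j).trans (hanti hs (Nat.zero_le k))
    rwa [edgeWeight_eq_one hadj hij, one_mul] at this
  have hU0 : 0 ≤ U := energy_nonneg (edgeWeight_nonneg col) hρ _ _
  -- The energy bounds multipliers only on oriented edges, hence the weights; it bounds `x k j₀`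
  -- because `j₀` has an incoming edge.
  let v : ℕ → (Fin P → Fin P → EuclideanSpace ℝ (Fin n)) × EuclideanSpace ℝ (Fin n) :=
    fun k => (fun i j => edgeWeight col i j • (multiplier ρ x k i j - Λ i j), x k j₀ - xs)
  have hv : ∀ k, v k ∈ Metric.closedBall (0 : (Fin P → Fin P → EuclideanSpace ℝ (Fin n)) ×
      EuclideanSpace ℝ (Fin n)) (Real.sqrt (2 * ρ * U) + Real.sqrt (2 / ρ * U)) := by
    intro k
    have hs1 := Real.sqrt_nonneg (2 * ρ * U)
    have hs2 := Real.sqrt_nonneg (2 / ρ * U)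
    rw [mem_closedBall_zero_iff, norm_prod_le_iff]
    constructor
    · refine (pi_norm_le_iff_of_nonneg (by positivity)).mpr fun i =>
        (pi_norm_le_iff_of_nonneg (by positivity)).mpr fun j => ?_
      change ‖edgeWeight col i j • (multiplier ρ x k i j - Λ i j)‖ ≤ _
      by_cases hij : G.Adj i j ∧ col i < col j
      · rw [edgeWeight_eq_one hij.1 hij.2, one_smul]
        refine le_add_of_le_of_nonneg (Real.le_sqrt_of_sq_le ?_) hs2
        have h1 := hbound k i j hij.1 hij.2
        have h2 : 0 ≤ ρ / 2 * ‖x k j - xs‖ ^ 2 := by positivity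
        calc ‖multiplier ρ x k i j - Λ i j‖ ^ 2
            = 2 * ρ * (1 / (2 * ρ) * ‖multiplier ρ x k i j - Λ i j‖ ^ 2) := by field_simp
          _ ≤ 2 * ρ * U := by gcongr; linarith
      · rw [edgeWeight_eq_zero hij, zero_smul, norm_zero]
        positivity
    · change ‖x k j₀ - xs‖ ≤ _
      refine le_add_of_nonneg_of_le hs1 (Real.le_sqrt_of_sq_le ?_)
      have h1 := hbound k i₀ j₀ hadj₀ hij₀
      have h2 : 0 ≤ 1 / (2 * ρ) * ‖multiplier ρ x k i₀ j₀ - Λ i₀ j₀‖ ^ 2 := by positivity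
      calc ‖x k j₀ - xs‖ ^ 2 = 2 / ρ * (ρ / 2 * ‖x k j₀ - xs‖ ^ 2) := by field_simp
        _ ≤ 2 / ρ * U := by gcongr; linarith
  obtain ⟨m, _, φ, hφ, hlim⟩ := tendsto_subseq_of_bounded Metric.isBounded_closedBall hv
  set Γ : Fin P → Fin P → EuclideanSpace ℝ (Fin n) := fun i j => m.1 i j + Λ i j with hΓ
  set y := m.2 + xs with hy
  have hmult : ∀ i j, G.Adj i j → col i < col j →
      Tendsto (fun k => multiplier ρ x (φ k) i j) atTop (𝓝 (Γ i j)) := by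
    intro i j hadj hij
    have h1 := tendsto_pi_nhds.mp (tendsto_pi_nhds.mp ((continuous_fst.tendsto m).comp hlim) i) j
    have h2 := h1.add_const (Λ i j)
    refine h2.congr fun k => ?_
    simp [v, edgeWeight_eq_one hadj hij]
  have hx₀ : Tendsto (fun k => x (φ k) j₀) atTop (𝓝 y) := by
    have h1 := ((continuous_snd.tendsto m).comp hlim).add_const xs
    refine h1.congr fun k => ?_
    simp [v]
  have hx : ∀ p, Tendsto (fun k => x (φ k) p) atTop (𝓝 y) := by
    intro p
    have := ((h.tendsto_sub hP hG hf hρ hs p j₀).comp hφ.tendsto_atTop).add hx₀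
    rw [zero_add] at this
    refine this.congr fun k => ?_
    simp
  have hincr : ∀ p, Tendsto (fun k => x (φ k + 1) p - x (φ k) p) atTop (𝓝 0) := fun p =>
    (h.tendsto_increment hP hG hf hρ hs p).comp hφ.tendsto_atTop
  have hx' : ∀ p, Tendsto (fun k => x (φ k + 1) p) atTop (𝓝 y) := by
    intro p
    simpa using (hincr p).add (hx p)
  have hmult' : ∀ i j, G.Adj i j → col i < col j →
      Tendsto (fun k => multiplier ρ x (φ k + 1) i j) atTop (𝓝 (Γ i j)) := by
    intro i j hadj hij
    simp only [multiplier_succ]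
    simpa using (hmult i j hadj hij).add (((hx' i).sub (hx' j)).const_smul ρ)
  have hweighted : ∀ i j, Tendsto (fun k => edgeWeight col i j • multiplier ρ x (φ k + 1) i j) atTop
      (𝓝 (edgeWeight col i j • Γ i j)) := by
    intro i j
    by_cases hij : G.Adj i j ∧ col i < col j
    · exact (hmult' i j hij.1 hij.2).const_smul _
    · simp [edgeWeight_eq_zero hij]
  -- The correction term tends to zero with the increments, and the graph of the subdifferential is
  -- closed.
  have hsaddle : IsSaddle col f y Γ := by
    intro p
    refine IsSubgradient.of_tendsto (hf p) (l := atTop)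
      (fun k => h.isSubgradient hP hG hf hρ (φ k) p) (hx' p) ?_
    have h1 : Tendsto (fun k => divergence (edgeWeight col) (multiplier ρ x (φ k + 1)) p) atTop
        (𝓝 (divergence (edgeWeight col) Γ p)) :=
      (tendsto_finsetSum _ fun j _ => hweighted p j).sub
        (tendsto_finsetSum _ fun i _ => hweighted i p)
    have h2 : Tendsto (fun k => ρ • ∑ j, edgeWeight col p j • (x (φ k + 1) j - x (φ k) j)) atTop
        (𝓝 0) := by
      simpa using (tendsto_finsetSum univ fun j _ =>
        (hincr j).const_smul (edgeWeight col p j)).const_smul ρ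
    have h3 := (h1.add h2).neg
    rwa [add_zero] at h3
  have henergy : Tendsto (fun k => energy (edgeWeight col) ρ (multiplier ρ x k - Γ)
      (x k - Function.const (Fin P) y)) atTop (𝓝 0) := by
    -- The energy relative to the new saddle point is antitone, so a subsequence decides its limit.
    rw [tendsto_iff_tendsto_subseq_of_antitone (hanti hsaddle) hφ.tendsto_atTop]
    have hzero : (0 : ℝ) = ∑ i : Fin P, ∑ j : Fin P, (0 : ℝ) := by simp
    rw [hzero]
    refine tendsto_finsetSum _ fun i _ => tendsto_finsetSum _ fun j _ => ?_
    by_cases hij : G.Adj i j ∧ col i < col j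
    · have h1 := ((hmult i j hij.1 hij.2).sub_const (Γ i j)).norm.pow 2
      have h2 := ((hx j).sub_const y).norm.pow 2
      simpa using ((h1.const_mul (1 / (2 * ρ))).add (h2.const_mul (ρ / 2))).const_mul
        (edgeWeight col i j)
    · simp [edgeWeight_eq_zero hij]
  have hfinal : Tendsto (fun k => x k j₀ - y) atTop (𝓝 0) := by
    refine tendsto_zero_of_sq_le (fun k => ?_) (by simpa using henergy.const_mul (2 / ρ))
    have h1 := mul_le_energy (edgeWeight_nonneg col) hρ (multiplier ρ x k - Γ) (x k - Function.const (Fin P) y)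
      i₀ j₀
    rw [edgeWeight_eq_one hadj₀ hij₀, one_mul] at h1
    have h2 : 0 ≤ 1 / (2 * ρ) * ‖(multiplier ρ x k - Γ) i₀ j₀‖ ^ 2 := by positivity
    calc ‖x k j₀ - y‖ ^ 2 = 2 / ρ * (ρ / 2 * ‖(x k - Function.const (Fin P) y) j₀‖ ^ 2) := by
          simp only [Pi.sub_apply, Function.const_apply]
          field_simp
      _ ≤ _ := by gcongr; linarith
  refine ⟨y, hsaddle.isSolution hf, fun p => ?_⟩
  have := ((h.tendsto_sub hP hG hf hρ hs p j₀).add hfinal).add_const y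
  simpa using this

end

/-! ### Convergence under strong convexity -/

section

/-- Adding the partial sums of `b` to `L` makes it monotone and keeps it bounded. -/
theorem exists_tendsto_and_summable_of_almost_ascent {L a b : ℕ → ℝ} {M : ℝ} (ha : ∀ k, 0 ≤ a k)
    (hb : ∀ k, 0 ≤ b k) (hbs : Summable b) (hL : ∀ k, L k ≤ M)
    (h : ∀ k, L k + a k ≤ L (k + 1) + b k) : (∃ l, Tendsto L atTop (𝓝 l)) ∧ Summable a := by
  have hbsum : ∀ K, ∑ k ∈ range K, b k ≤ ∑' k, b k := fun K => hbs.sum_le_tsum _ fun k _ => hb k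
  constructor
  · have hmono : Monotone fun k => L k + ∑ i ∈ range k, b i := by
      refine monotone_nat_of_le_succ fun k => ?_
      rw [sum_range_succ]
      linarith [h k, ha k]
    have hbdd : BddAbove (Set.range fun k => L k + ∑ i ∈ range k, b i) := by
      refine ⟨M + ∑' k, b k, ?_⟩
      rintro _ ⟨k, rfl⟩
      exact add_le_add (hL k) (hbsum k)
    refine ⟨_, ((tendsto_atTop_ciSup hmono hbdd).sub hbs.hasSum.tendsto_sum_nat).congr fun k => ?_⟩
    ring
  · refine summable_of_sum_range_le (c := M + ∑' k, b k - L 0) ha fun K => ?_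
    have : ∑ k ∈ range K, a k ≤ L K - L 0 + ∑ k ∈ range K, b k := by
      induction K with
      | zero => simp
      | succ K ih => rw [sum_range_succ, sum_range_succ]; linarith [h K]
    linarith [hL K, hbsum K]

/-- Otherwise `q` eventually dominates a multiple of the harmonic series. -/
theorem frequently_mul_lt_of_summable {q : ℕ → ℝ} (hqs : Summable q) {ε : ℝ} (hε : 0 < ε) :
    ∃ᶠ k : ℕ in atTop, ((k : ℝ) + 1) * q k < ε := by
  intro hcon
  simp only [not_lt] at hcon
  have h1 : Summable fun k : ℕ => ε * (1 / ((k : ℝ) + 1)) := by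
    refine Summable.of_norm_bounded_eventually_nat hqs ?_
    filter_upwards [hcon] with k hk
    have hk0 : (0 : ℝ) < k + 1 := by positivity
    rw [Real.norm_of_nonneg (by positivity), mul_one_div, div_le_iff₀ hk0]
    linarith
  rw [summable_mul_left_iff hε.ne'] at h1
  refine Real.not_summable_one_div_natCast ((summable_nat_add_iff 1).mp ?_)
  simpa using h1

theorem sq_sum_sum_le {ι : Type*} [Fintype ι] (t : ι → ι → ℝ) :
    (∑ i, ∑ j, t i j) ^ 2 ≤ (Fintype.card ι : ℝ) ^ 2 * ∑ i, ∑ j, t i j ^ 2 := by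
  calc (∑ i, ∑ j, t i j) ^ 2 ≤ (Fintype.card ι : ℝ) * ∑ i, (∑ j, t i j) ^ 2 :=
        sq_sum_le_card_mul_sum_sq
    _ ≤ (Fintype.card ι : ℝ) * ∑ i, (Fintype.card ι : ℝ) * ∑ j, t i j ^ 2 := by
        gcongr
        exact sq_sum_le_card_mul_sum_sq
    _ = (Fintype.card ι : ℝ) ^ 2 * ∑ i, ∑ j, t i j ^ 2 := by rw [← mul_sum]; ring

theorem lowerSemicontinuous_sum_apply {n P : ℕ} {f : Fin P → EuclideanSpace ℝ (Fin n) → EReal}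
    (hf : ∀ p, IsClosedProperConvex (f p)) :
    LowerSemicontinuous fun X : Fin P → EuclideanSpace ℝ (Fin n) => ∑ p, f p (X p) := by
  have key : ∀ s : Finset (Fin P),
      LowerSemicontinuous fun X : Fin P → EuclideanSpace ℝ (Fin n) => ∑ p ∈ s, f p (X p) := by
    intro s
    induction s using Finset.induction_on with
    | empty => simpa using lowerSemicontinuous_const
    | insert p s hp ih =>
      simp only [sum_insert hp]
      refine LowerSemicontinuous.add' ?_ ih fun X => ?_
      · exact (hf p).lowerSemicontinuous.comp (continuous_apply p)
      · exact EReal.continuousAt_add (Or.inr (ereal_sum_ne_bot fun p => (hf p).ne_bot _))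
          (Or.inl ((hf p).ne_bot _))
  exact key univ

section Run

variable {n P C : ℕ} {G : SimpleGraph (Fin P)} [DecidableRel G.Adj]
  {f : Fin P → EuclideanSpace ℝ (Fin n) → EReal} {col : G.Coloring (Fin C)} {ρ : ℝ}
  {x γ : ℕ → Fin P → EuclideanSpace ℝ (Fin n)} {xs : EuclideanSpace ℝ (Fin n)} {μ : Fin P → ℝ}

theorem edgeWeight_le_one (col : G.Coloring (Fin C)) (i j : Fin P) : edgeWeight col i j ≤ 1 := by
  unfold edgeWeight
  split_ifs <;> norm_num

theorem edgeWeight_sq (col : G.Coloring (Fin C)) (i j : Fin P) :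
    edgeWeight col i j ^ 2 = edgeWeight col i j := by
  unfold edgeWeight
  split_ifs <;> norm_num

/-- Strong monotonicity bounds `μ p` times the squared increment by the summable pairing. -/
theorem IsRun.summable_increment_sq (hP : 2 ≤ P) (hG : G.Connected)
    (hf : ∀ p, IsClosedProperConvex (f p)) (hρ : 0 < ρ) (h : IsRun G col f ρ x γ)
    (hμ : ∀ p, IsStronglyConvex (μ p) (f p)) (p : Fin P) :
    Summable fun k => ‖x (k + 1) p - x k p‖ ^ 2 := by
  rw [← summable_nat_add_iff 1]
  refine ((h.summable_inner_sub hP hG hf hρ p).div_const (μ p)).of_nonneg_of_le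
    (fun k => by positivity) fun k => ?_
  rw [le_div_iff₀ (hμ p).1, mul_comm]
  exact (h.isSubgradient hP hG hf hρ (k + 1) p).mul_sq_le_inner
    (h.isSubgradient hP hG hf hρ k p) (hf p) (hμ p)

/-- The value of the Lagrangian after `k + 1` iterations. -/
noncomputable def lagrangianIterate (f : Fin P → EuclideanSpace ℝ (Fin n) → EReal)
    (x γ : ℕ → Fin P → EuclideanSpace ℝ (Fin n)) (k : ℕ) : ℝ :=
  ∑ p, ((f p (x (k + 1) p)).toReal + inner ℝ (γ (k + 1) p) (x (k + 1) p))

/-- The difference between the subgradient of a sweep and the negative dual variable. -/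
def sweepError (col : G.Coloring (Fin C)) (ρ : ℝ) (x : ℕ → Fin P → EuclideanSpace ℝ (Fin n))
    (k : ℕ) (p : Fin P) : EuclideanSpace ℝ (Fin n) :=
  ρ • ∑ j, edgeWeight col p j • (x (k + 1) j - x k j)

/-- The violation of the edge constraints after `k + 1` iterations. -/
noncomputable def edgeViolation (col : G.Coloring (Fin C)) (x : ℕ → Fin P → EuclideanSpace ℝ (Fin n)) (k : ℕ) :
    ℝ :=
  ∑ i, ∑ j, edgeWeight col i j * ‖x (k + 1) i - x (k + 1) j‖ ^ 2

theorem edgeViolation_nonneg (col : G.Coloring (Fin C))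
    (x : ℕ → Fin P → EuclideanSpace ℝ (Fin n)) (k : ℕ) : 0 ≤ edgeViolation col x k :=
  sum_nonneg fun i _ => sum_nonneg fun j _ => mul_nonneg (edgeWeight_nonneg col i j) (by positivity)

theorem sq_norm_sub_le_edgeViolation (x : ℕ → Fin P → EuclideanSpace ℝ (Fin n)) (k : ℕ)
    {i j : Fin P} (hadj : G.Adj i j) (hij : col i < col j) :
    ‖x (k + 1) i - x (k + 1) j‖ ^ 2 ≤ edgeViolation col x k := by
  have h0 : ∀ i j, 0 ≤ edgeWeight col i j * ‖x (k + 1) i - x (k + 1) j‖ ^ 2 :=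
    fun i j => mul_nonneg (edgeWeight_nonneg col i j) (by positivity)
  refine le_trans ?_ (single_le_sum
    (f := fun i => ∑ j, edgeWeight col i j * ‖x (k + 1) i - x (k + 1) j‖ ^ 2)
    (fun i _ => sum_nonneg fun j _ => h0 i j) (mem_univ i))
  refine le_trans ?_ (single_le_sum (fun j _ => h0 i j) (mem_univ j))
  rw [edgeWeight_eq_one hadj hij, one_mul]

theorem IsRun.summable_sweepError_sq (hP : 2 ≤ P) (hG : G.Connected)
    (hf : ∀ p, IsClosedProperConvex (f p)) (hρ : 0 < ρ) (h : IsRun G col f ρ x γ)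
    (hμ : ∀ p, IsStronglyConvex (μ p) (f p)) (p : Fin P) :
    Summable fun k => ‖sweepError col ρ x k p‖ ^ 2 := by
  have hs := (summable_sum fun j (_ : j ∈ univ) =>
    h.summable_increment_sq hP hG hf hρ hμ j).mul_left (ρ ^ 2 * P)
  refine hs.of_nonneg_of_le (fun k => by positivity) fun k => ?_
  rw [sweepError, norm_smul, mul_pow, Real.norm_eq_abs, sq_abs, mul_assoc]
  refine mul_le_mul_of_nonneg_left ?_ (by positivity)
  calc ‖∑ j, edgeWeight col p j • (x (k + 1) j - x k j)‖ ^ 2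
      ≤ (∑ j, ‖x (k + 1) j - x k j‖) ^ 2 := by
        gcongr
        refine (norm_sum_le _ _).trans (sum_le_sum fun j _ => ?_)
        rw [norm_smul, Real.norm_of_nonneg (edgeWeight_nonneg col p j)]
        exact mul_le_of_le_one_left (norm_nonneg _) (edgeWeight_le_one col p j)
    _ ≤ (P : ℝ) * ∑ j, ‖x (k + 1) j - x k j‖ ^ 2 := by
        have := sq_sum_le_card_mul_sum_sq (s := univ) (f := fun j => ‖x (k + 1) j - x k j‖)
        rwa [card_univ, Fintype.card_fin] at this

theorem IsRun.isSubgradient_neg (hP : 2 ≤ P) (hG : G.Connected)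
    (hf : ∀ p, IsClosedProperConvex (f p)) (hρ : 0 < ρ) (h : IsRun G col f ρ x γ) (k : ℕ)
    (p : Fin P) :
    IsSubgradient (f p) (x (k + 1) p) (-(γ (k + 1) p + sweepError col ρ x k p)) := by
  rw [h.γ_eq]
  exact h.isSubgradient hP hG hf hρ k p

theorem IsRun.sum_γ (h : IsRun G col f ρ x γ) (k : ℕ) : ∑ p, γ k p = 0 := by
  simp_rw [h.γ_eq]
  exact sum_divergence _ _

theorem IsRun.sum_inner_γ (h : IsRun G col f ρ x γ) (k : ℕ) (y : Fin P → EuclideanSpace ℝ (Fin n)) :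
    ∑ p, inner ℝ (γ k p) (y p)
      = ∑ i, ∑ j, edgeWeight col i j * inner ℝ (multiplier ρ x k i j) (y i - y j) := by
  simp_rw [h.γ_eq]
  exact sum_inner_divergence _ _ _

/-- The multiplier update is an ascent step that gains `ρ` times the edge violation. Replacing `x (k
+ 1)` by `x (k + 2)` at fixed `γ (k + 1)` loses at most the error pairing, since `x (k + 1)`
minimizes that Lagrangian up to `sweepError`. -/
theorem IsRun.lagrangianIterate_ascent (hP : 2 ≤ P) (hG : G.Connected)
    (hf : ∀ p, IsClosedProperConvex (f p)) (hρ : 0 < ρ) (h : IsRun G col f ρ x γ) (k : ℕ) :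
    lagrangianIterate f x γ k + ρ * edgeViolation col x (k + 1)
      ≤ lagrangianIterate f x γ (k + 1)
        + ∑ p, inner ℝ (sweepError col ρ x k p) (x (k + 2) p - x (k + 1) p) := by
  have h1 : ρ * edgeViolation col x (k + 1)
      = ∑ p, inner ℝ (γ (k + 2) p) (x (k + 2) p) - ∑ p, inner ℝ (γ (k + 1) p) (x (k + 2) p) := by
    rw [h.sum_inner_γ, h.sum_inner_γ, edgeViolation, mul_sum, ← sum_sub_distrib]
    refine sum_congr rfl fun i _ => ?_
    rw [mul_sum, ← sum_sub_distrib]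
    refine sum_congr rfl fun j _ => ?_
    rw [multiplier_succ ρ x (k + 1), inner_add_left, inner_smul_left, real_inner_self_eq_norm_sq]
    simp only [conj_trivial]
    ring
  rw [h1, ← sub_nonneg]
  simp only [lagrangianIterate, ← sum_sub_distrib, ← sum_add_distrib]
  refine sum_nonneg fun p _ => ?_
  have h2 := (h.isSubgradient_neg hP hG hf hρ k p).toReal_le (hf p)
    (h.isSubgradient_neg hP hG hf hρ (k + 1) p).1
  rw [inner_neg_left, inner_add_left] at h2
  simp only [inner_sub_right] at h2 ⊢
  linarith

/-- Compare with `xs`, whose pairing with `γ` vanishes because the `γ` sum to zero. Half of the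
strong convexity term absorbs the sweep error by Young's inequality; the other half remains. -/
theorem IsRun.lagrangianIterate_le (hP : 2 ≤ P) (hG : G.Connected)
    (hf : ∀ p, IsClosedProperConvex (f p)) (hρ : 0 < ρ) (h : IsRun G col f ρ x γ)
    (hμ : ∀ p, IsStronglyConvex (μ p) (f p)) (hxs : IsSolution f xs) (k : ℕ) :
    lagrangianIterate f x γ k + ∑ p, μ p / 4 * ‖x (k + 1) p - xs‖ ^ 2
      ≤ ∑ p, (f p xs).toReal + ∑ p, ‖sweepError col ρ x k p‖ ^ 2 / μ p := by
  have h0 : ∑ p, inner ℝ (γ (k + 1) p) xs = 0 := by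
    rw [← sum_inner, h.sum_γ, inner_zero_left]
  rw [← add_zero (∑ p, (f p xs).toReal), ← h0, ← sub_nonneg]
  simp only [lagrangianIterate, ← sum_sub_distrib, ← sum_add_distrib]
  refine sum_nonneg fun p _ => ?_
  have h1 := (h.isSubgradient_neg hP hG hf hρ k p).toReal_add_sq_le (hf p) (hμ p)
    (hxs.ne_top hf p)
  have hμp := (hμ p).1
  set e := sweepError col ρ x k p
  set d := xs - x (k + 1) p with hd
  have h2 : ‖x (k + 1) p - xs‖ = ‖d‖ := norm_sub_rev _ _
  have h3 : inner ℝ e d ≤ ‖e‖ ^ 2 / μ p + μ p / 4 * ‖d‖ ^ 2 := by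
    have hsq : 0 ≤ (‖e‖ - μ p / 2 * ‖d‖) ^ 2 / μ p := by positivity
    have heq : (‖e‖ - μ p / 2 * ‖d‖) ^ 2 / μ p
        = ‖e‖ ^ 2 / μ p + μ p / 4 * ‖d‖ ^ 2 - ‖e‖ * ‖d‖ := by
      field_simp
      ring
    linarith [real_inner_le_norm e d]
  have h4 : inner ℝ (γ (k + 1) p) d
      = inner ℝ (γ (k + 1) p) xs - inner ℝ (γ (k + 1) p) (x (k + 1) p) := inner_sub_right _ _ _
  rw [inner_neg_left, inner_add_left, h4] at h1
  rw [h2]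
  linarith

/-- By Cauchy–Schwarz, a multiplier with square-summable increments grows at most like `√k`. -/
theorem sq_norm_multiplier_le (hρ : 0 < ρ) {q : ℕ → ℝ} (hq0 : ∀ k, 0 ≤ q k) (hq : Summable q)
    {i j : Fin P} (hij : ∀ k, ‖x (k + 1) i - x (k + 1) j‖ ^ 2 ≤ q k) (k : ℕ) :
    ‖multiplier ρ x k i j‖ ^ 2 ≤ ρ ^ 2 * k * ∑' t, q t := by
  rw [multiplier, norm_smul, mul_pow, Real.norm_of_nonneg hρ.le, mul_assoc]
  refine mul_le_mul_of_nonneg_left ?_ (by positivity)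
  calc ‖∑ t ∈ range k, (x (t + 1) i - x (t + 1) j)‖ ^ 2
      ≤ (∑ t ∈ range k, ‖x (t + 1) i - x (t + 1) j‖) ^ 2 := by
        gcongr
        exact norm_sum_le _ _
    _ ≤ (k : ℝ) * ∑ t ∈ range k, ‖x (t + 1) i - x (t + 1) j‖ ^ 2 := by
        have := sq_sum_le_card_mul_sum_sq (s := range k)
          (f := fun t => ‖x (t + 1) i - x (t + 1) j‖)
        rwa [card_range] at this
    _ ≤ (k : ℝ) * ∑' t, q t := by
        gcongr
        exact (sum_le_sum fun t _ => hij t).trans (hq.sum_le_tsum _ fun t _ => hq0 t)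

/-- D-ADMM converges, for any number of colors and any `ρ > 0`, if all functions are strongly convex.
No multiplier is needed: the values of the Lagrangian along the iterates increase up to a summable
error, and their limit is the optimal value. -/
theorem IsRun.tendsto_of_isStronglyConvex (hP : 2 ≤ P) (hG : G.Connected)
    (hf : ∀ p, IsClosedProperConvex (f p)) (hρ : 0 < ρ) (h : IsRun G col f ρ x γ)
    (hμ : ∀ p, IsStronglyConvex (μ p) (f p)) (hxs : IsSolution f xs) (p : Fin P) :
    Tendsto (fun k => x k p) atTop (𝓝 xs) := by
  set Fs := ∑ p, (f p xs).toReal with hFs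
  set E : ℕ → ℝ := fun k => ∑ p, ‖sweepError col ρ x k p‖ ^ 2 / μ p with hE
  have hμ0 : ∀ p, 0 < μ p := fun p => (hμ p).1
  have hE0 : ∀ k, 0 ≤ E k := fun k => sum_nonneg fun p _ => by have := hμ0 p; positivity
  have hEs : Summable E := summable_sum fun p _ =>
    (h.summable_sweepError_sq hP hG hf hρ hμ p).div_const (μ p)
  have hupper := h.lagrangianIterate_le hP hG hf hρ hμ hxs
  have hdist0 : ∀ k, 0 ≤ ∑ p, μ p / 4 * ‖x (k + 1) p - xs‖ ^ 2 := fun k =>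
    sum_nonneg fun p _ => by have := hμ0 p; positivity
  set b : ℕ → ℝ := fun k =>
    ∑ p, (‖sweepError col ρ x k p‖ ^ 2 + ‖x (k + 1 + 1) p - x (k + 1) p‖ ^ 2) with hb
  have hbs : Summable b := summable_sum fun p _ =>
    (h.summable_sweepError_sq hP hG hf hρ hμ p).add
      ((summable_nat_add_iff 1).mpr (h.summable_increment_sq hP hG hf hρ hμ p))
  have hinner : ∀ k, ∑ p, inner ℝ (sweepError col ρ x k p) (x (k + 2) p - x (k + 1) p) ≤ b k := by
    intro k
    refine sum_le_sum fun p _ => (real_inner_le_norm _ _).trans ?_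
    nlinarith [sq_nonneg (‖sweepError col ρ x k p‖ - ‖x (k + 2) p - x (k + 1) p‖),
      sq_nonneg ‖sweepError col ρ x k p‖, sq_nonneg ‖x (k + 2) p - x (k + 1) p‖]
  obtain ⟨⟨l, hl⟩, hqs⟩ := exists_tendsto_and_summable_of_almost_ascent
    (L := lagrangianIterate f x γ) (a := fun k => ρ * edgeViolation col x (k + 1)) (b := b)
    (M := Fs + ∑' k, E k)
    (fun k => mul_nonneg hρ.le (edgeViolation_nonneg col x _))
    (fun k => sum_nonneg fun p _ => by positivity) hbs
    (fun k => by linarith [hupper k, hdist0 k, hEs.le_tsum k fun j _ => hE0 j])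
    (fun k => (h.lagrangianIterate_ascent hP hG hf hρ k).trans (by linarith [hinner k]))
  rw [summable_mul_left_iff hρ.ne', summable_nat_add_iff 1 (f := edgeViolation col x)] at hqs
  have hq0 := edgeViolation_nonneg col x
  have hconsensus : ∀ i j, Tendsto (fun k => x k i - x k j) atTop (𝓝 0) := by
    refine tendsto_sub_of_adj (col := col) hG fun i j hadj hij => ?_
    rw [← tendsto_add_atTop_iff_nat 1]
    exact tendsto_zero_of_sq_le (fun k => sq_norm_sub_le_edgeViolation x k hadj hij)
      hqs.tendsto_atTop_zero
  have hgap : Tendsto (fun k => Fs + E k - lagrangianIterate f x γ k) atTop (𝓝 (Fs - l)) := by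
    simpa using (hEs.tendsto_atTop_zero.const_add Fs).sub hl
  have hdist : ∀ k, μ p / 4 * ‖x (k + 1) p - xs‖ ^ 2 ≤ Fs + E k - lagrangianIterate f x γ k := by
    intro k
    have := single_le_sum (f := fun p => μ p / 4 * ‖x (k + 1) p - xs‖ ^ 2)
      (fun p _ => by have := hμ0 p; positivity) (mem_univ p)
    linarith [hupper k]
  -- The gap bounds the squared distance to `xs`, so it only remains to show that its limit is zero.
  suffices hFl : Fs = l by
    have hlim := hgap.const_mul (4 / μ p)
    rw [sub_eq_zero.mpr hFl, mul_zero] at hlim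
    have h1 : Tendsto (fun k => x (k + 1) p - xs) atTop (𝓝 0) := by
      refine tendsto_zero_of_sq_le (fun k => ?_) hlim
      calc ‖x (k + 1) p - xs‖ ^ 2 = 4 / μ p * (μ p / 4 * ‖x (k + 1) p - xs‖ ^ 2) := by
            have := (hμ0 p).ne'
            field_simp
        _ ≤ 4 / μ p * (Fs + E k - lagrangianIterate f x γ k) := by
            have := hμ0 p
            have := hdist k
            gcongr
    rw [← tendsto_add_atTop_iff_nat 1]
    simpa using h1.add_const xs
  have hlower : l ≤ Fs := by
    have : 0 ≤ Fs - l := ge_of_tendsto' hgap fun k => by linarith [hupper k, hdist0 k]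
    linarith
  refine le_antisymm ?_ hlower
  -- the pairing of the multipliers with the constraint violation vanishes along a subsequence
  obtain ⟨ψ, hψ, hψq⟩ := extraction_forall_of_frequently fun m : ℕ =>
    frequently_mul_lt_of_summable hqs (ε := 1 / ((m : ℝ) + 1)) (by positivity)
  have hψlim : Tendsto (fun m => ((ψ m : ℝ) + 1) * edgeViolation col x (ψ m)) atTop (𝓝 0) :=
    squeeze_zero (fun m => mul_nonneg (by positivity) (hq0 _)) (fun m => (hψq m).le)
      tendsto_one_div_add_atTop_nhds_zero_nat
  set pairing : ℕ → ℝ := fun k => ∑ p, inner ℝ (γ (k + 1) p) (x (k + 1) p) with hpairing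
  -- The linear growth of the squared multipliers is paired with the violation, leaving `(k + 1)`
  -- times the violation.
  have hpair : ∀ k, pairing k ^ 2 ≤ (P : ℝ) ^ 2 * (ρ ^ 2 * ∑' t, edgeViolation col x t)
      * (((k : ℝ) + 1) * edgeViolation col x k) := by
    intro k
    rw [hpairing]
    simp only
    rw [h.sum_inner_γ]
    refine (sq_sum_sum_le _).trans ?_
    rw [Fintype.card_fin, mul_assoc]
    refine mul_le_mul_of_nonneg_left ?_ (by positivity)
    rw [edgeViolation, ← mul_assoc, mul_sum]
    refine sum_le_sum fun i _ => ?_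
    rw [mul_sum]
    refine sum_le_sum fun j _ => ?_
    rw [mul_pow, edgeWeight_sq]
    by_cases hij : G.Adj i j ∧ col i < col j
    · rw [edgeWeight_eq_one hij.1 hij.2, one_mul, one_mul]
      have h1 := sq_norm_multiplier_le (x := x) hρ hq0 hqs (i := i) (j := j)
        (fun k => sq_norm_sub_le_edgeViolation x k hij.1 hij.2) (k + 1)
      push_cast at h1
      have h2 : inner ℝ (multiplier ρ x (k + 1) i j) (x (k + 1) i - x (k + 1) j) ^ 2
          ≤ ‖multiplier ρ x (k + 1) i j‖ ^ 2 * ‖x (k + 1) i - x (k + 1) j‖ ^ 2 := by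
        rw [← mul_pow, ← sq_abs]
        gcongr
        exact abs_real_inner_le_norm _ _
      refine h2.trans (mul_le_mul_of_nonneg_right (h1.trans_eq (by ring)) (by positivity))
    · rw [edgeWeight_eq_zero hij]
      simp
  have hpairlim : Tendsto (fun m => pairing (ψ m)) atTop (𝓝 0) := by
    have h1 := hψlim.const_mul ((P : ℝ) ^ 2 * (ρ ^ 2 * ∑' t, edgeViolation col x t))
    rw [mul_zero] at h1
    refine tendsto_zero_of_sq_le (fun m => ?_) h1
    rw [Real.norm_eq_abs, sq_abs]
    exact hpair (ψ m)
  have hFlim : Tendsto (fun m => ∑ p, (f p (x (ψ m + 1) p)).toReal) atTop (𝓝 l) := by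
    have h1 := (hl.comp hψ.tendsto_atTop).sub hpairlim
    rw [sub_zero] at h1
    refine h1.congr fun m => ?_
    simp [lagrangianIterate, hpairing, sum_add_distrib]
  obtain ⟨M, hM⟩ := hgap.bddAbove_range
  have hball : ∀ m, x (ψ m + 1) p ∈ Metric.closedBall xs (Real.sqrt (4 / μ p * M)) := by
    intro m
    rw [mem_closedBall_iff_norm]
    refine Real.le_sqrt_of_sq_le ?_
    have h1 := (hdist (ψ m)).trans (hM ⟨ψ m, rfl⟩)
    have hμp := hμ0 p
    calc ‖x (ψ m + 1) p - xs‖ ^ 2 = 4 / μ p * (μ p / 4 * ‖x (ψ m + 1) p - xs‖ ^ 2) := by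
          field_simp
      _ ≤ 4 / μ p * M := by gcongr
  obtain ⟨y, _, φ, hφ, hy⟩ := tendsto_subseq_of_bounded Metric.isBounded_closedBall hball
  have hX : Tendsto (fun m => x (ψ (φ m) + 1)) atTop (𝓝 (Function.const (Fin P) y)) := by
    refine tendsto_pi_nhds.mpr fun q => ?_
    have h1 := (((tendsto_add_atTop_iff_nat 1).mpr (hconsensus q p)).comp
      (hψ.tendsto_atTop.comp hφ.tendsto_atTop)).add hy
    rw [zero_add] at h1
    refine h1.congr fun m => ?_
    simp
  -- By consensus all blocks tend to the same `y`, where lower semicontinuity bounds the objective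
  -- by the limit `l`.
  have hle : ∑ p, f p y ≤ (l : EReal) := by
    by_contra hcon
    rw [not_le] at hcon
    obtain ⟨c, hlc, hcy⟩ := exists_between hcon
    have h1 := hX.eventually (lowerSemicontinuous_sum_apply hf (Function.const (Fin P) y) c hcy)
    have h2 : Tendsto (fun m => ((∑ p, (f p (x (ψ (φ m) + 1) p)).toReal : ℝ) : EReal)) atTop
        (𝓝 (l : EReal)) :=
      (continuous_coe_real_ereal.tendsto l).comp (hFlim.comp hφ.tendsto_atTop)
    refine hlc.not_ge (ge_of_tendsto h2 (h1.mono fun m hm => ?_))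
    rw [coe_sum_toReal (fun p => (hf p).ne_bot _)
      fun p => (h.isSubgradient hP hG hf hρ (ψ (φ m)) p).1]
    exact hm.le
  have hfin := (hxs.2 y).trans hle
  rw [← coe_sum_toReal (fun p => (hf p).ne_bot xs) (hxs.ne_top hf)] at hfin
  exact_mod_cast hfin

end Run

end

end DADMM

/-! ### Well-posedness and convergence of D-ADMM -/

theorem mainTheorem2 {n P C : ℕ} (hP : 2 ≤ P)
    (f : Fin P → EuclideanSpace ℝ (Fin n) → EReal)
    (hf : ∀ p, DADMM.IsClosedProperConvex (f p))
    (hsol : ∃ xs, DADMM.IsSolution f xs)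
    (G : SimpleGraph (Fin P)) [DecidableRel G.Adj] (hG : G.Connected)
    (col : G.Coloring (Fin C)) (hcol : Function.Surjective col)
    (ρ : ℝ) (hρ : 0 < ρ)
    (hcond :
      (C = 2 ∧ DADMM.StrongDuality G f) ∨
      (∃ μ : Fin P → ℝ, (∀ p, DADMM.IsStronglyConvex (μ p) (f p)) ∧
        ∀ c : Fin C, ρ < 2 * (∑ p ∈ DADMM.colorClass col c, μ p) /
          (3 * ((C : ℝ) - 1) * (DADMM.maxDegreeOfColor G col c : ℝ)))) :
    (∃ x γ : ℕ → Fin P → EuclideanSpace ℝ (Fin n), DADMM.IsRun G col f ρ x γ ∧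
      ∀ x' γ' : ℕ → Fin P → EuclideanSpace ℝ (Fin n),
        DADMM.IsRun G col f ρ x' γ' → x' = x ∧ γ' = γ) ∧
    ∀ x γ : ℕ → Fin P → EuclideanSpace ℝ (Fin n), DADMM.IsRun G col f ρ x γ →
      ∃ xs, DADMM.IsSolution f xs ∧
        ∀ p, Filter.Tendsto (fun k => x k p) Filter.atTop (nhds xs) := by
  obtain ⟨xs, hxs⟩ := hsol
  refine ⟨?_, fun x γ h => ?_⟩
  · obtain ⟨x, γ, h⟩ := DADMM.exists_isRun hP hf hG col hρ
    exact ⟨x, γ, h, fun x' γ' h' => h.unique hP hf hG hρ h'⟩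
  · rcases hcond with ⟨_, hdual⟩ | ⟨μ, hμ, _⟩
    · obtain ⟨Λ, hΛ⟩ := hdual.exists_isSaddle hf hG col hxs
      exact h.exists_tendsto_of_isSaddle hP hG hf hρ hΛ
    · exact ⟨xs, hxs, h.tendsto_of_isStronglyConvex hP hG hf hρ hμ hxs⟩
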